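/- Consider a stochastic multi-armed bandit with $K\ge 2$ arms. An environment is a tuple $\theta=(\nu_1,\dots,\nu_K)$ of probability measures on $[0,1]$, and it belongs to a set $\Theta=\Theta_1\times\dots\times\Theta_K$, where each $\Theta_k$ contains all the distributions $p\delta_a+(1-p)\delta_b$ with $p,a,b\in[0,1]$. Under $\mathbb P_\theta$ the rewards $X_{k,s}$ ($1\le k\le K$, $s\ge 1$) are independent, $X_{k,s}$ having law $\nu_k$. At each round $t\ge 1$ a policy chooses an arm $I_t$, possibly at random, on the basis of the past arms and past rewards only, and receives $X_{I_t,T_{I_t}(t)}$, where $T_k(t)=\#\{s\le t: I_s=k\}$. Let $\mu_k=\int x\,d\nu_k(x)$, $\mu^*=\max_k\mu_k$, $\Delta_k=\mu^*-\mu_k$, fix an arm $k^*$ with $\mu_{k^*}=\mu^*$, and let $$R_n=\sum_{t=1}^n X_{k^*,t}-\sum_{t=1}^n X_{I_t,T_{I_t}(t)}$$ be the regret after $n$ rounds. For $\alpha\in[0,1]$ a policy is called $\alpha$-consistent if $\mathbb E_\theta[R_n]=o(n^a)$ as $n\to\infty$, for every $a>\alpha$ and every $\theta\in\Theta$. The policy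 UCB($\rho$) draws each arm once and then, at each round $t>K$, draws an arm $$I_t\in\operatorname*{argmax}_{1\le k\le K}\left\{\hat X_{k,T_k(t-1)}+\sqrt{\frac{\rho\log t}{T_k(t-1)}}\right\},\qquad \hat X_{k,s}=\frac1s\sum_{u=1}^s X_{k,u},$$ with any order of the first $K$ draws and any rule for breaking ties. Let $\rho\in(0,\tfrac12)$. Then for UCB($\rho$), every $\theta\in\Theta$, every $\beta\in(0,1)$ and every $n\ge1$, $$\mathbb E_\theta[R_n]\le\sum_{k:\Delta_k>0}\left[\frac{4\log n}{\Delta_k}+2\Delta_k\left(\frac{\log n}{\log(1/\beta)}+1\right)\frac{n^{1-2\rho\beta}}{1-2\rho\beta}\right],$$ and consequently UCB($\rho$) is $(1-2\rho)$-consistent. Conversely, for every $\varepsilon>0$ there exists $\theta\in\Theta$, which can be chosen independently of the order of the first draws and of the tie-breaking rule, such that $$\lim_{n\to+\infty}\frac{\mathbb E_\theta[R_n]}{n^{1-2\rho-\varepsilon}}=+\infty.$$ -/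

import Mathlib

open MeasureTheory Filter Asymptotics

namespace Bandit

noncomputable section

/-- An environment with `K` arms: each arm has a reward distribution, a probability on `[0,1]`. -/
abbrev Env (K : ℕ) : Type := Fin K → ProbabilityMeasure unitInterval

/-- The probability `p δ_a + (1 - p) δ_b` on `[0,1]`. -/
def twoPoint (p a b : unitInterval) : ProbabilityMeasure unitInterval :=
  ⟨ENNReal.ofReal (p : ℝ) • Measure.dirac a + ENNReal.ofReal (1 - (p : ℝ)) • Measure.dirac b, by
    constructor
    simp only [Measure.coe_add, Measure.coe_smul, Pi.add_apply, Pi.smul_apply, measure_univ,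
      smul_eq_mul, mul_one]
    rw [← ENNReal.ofReal_add p.2.1 (sub_nonneg.2 p.2.2)]
    simp⟩

/-- The past decisions and outcomes after `t` rounds: the arm drawn and the reward received. -/
abbrev History (K t : ℕ) : Type := Fin t → Fin K × unitInterval

/-- A (possibly randomized) policy: after each history of length `t`, a probability on the arms,
from which the arm of round `t + 1` is drawn. Deterministic choices are Dirac masses `PMF.pure`. -/
structure Policy (K : ℕ) where
  choice : ∀ t : ℕ, History K t → PMF (Fin K)
  measurable_choice : ∀ (t : ℕ) (k : Fin K), Measurable fun h : History K t => choice t h k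

/-- The number of times arm `k` was pulled in the history `h`. -/
def pulls {K t : ℕ} (h : History K t) (k : Fin K) : ℕ :=
  (Finset.univ.filter fun i => (h i).1 = k).card

/-- The empirical mean of the rewards of arm `k` in the history `h`. -/
def empMean {K t : ℕ} (h : History K t) (k : Fin K) : ℝ :=
  (∑ i ∈ Finset.univ.filter (fun i => (h i).1 = k), ((h i).2 : ℝ)) / (pulls h k : ℝ)

/-- The index of arm `k` at round `t + 1`, given the history `h` of the first `t` rounds. -/
def ucbIndex (ρ : ℝ) {K t : ℕ} (h : History K t) (k : Fin K) : ℝ :=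
  empMean h k + Real.sqrt (ρ * Real.log ((t : ℝ) + 1) / (pulls h k : ℝ))

/-- `σ` is a `UCB(ρ)` policy: it first draws each arm once (in any order), and then always draws
an arm of maximal index (ties being broken in any way, possibly at random). -/
def IsUCB (ρ : ℝ) {K : ℕ} (σ : Policy K) : Prop :=
  ∀ (t : ℕ) (h : History K t), ∀ k ∈ (σ.choice t h).support,
    ((∃ j, pulls h j = 0) → pulls h k = 0) ∧
    ((∀ j, pulls h j ≠ 0) → ∀ j, ucbIndex ρ h j ≤ ucbIndex ρ h k)

/-- Sampling from a probability `p` on the arms by inversion of the distribution function: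
the least arm `k` with `u < p 0 + ⋯ + p k`. For `u` uniform on `[0,1]` the result has law `p`
(the default value matters only for `u = 1`). -/
def draw {K : ℕ} [NeZero K] (p : PMF (Fin K)) (u : unitInterval) : Fin K :=
  open Classical in
  if hne : (Finset.univ.filter fun k => (u : ℝ) < ∑ j ∈ Finset.Iic k, (p j).toReal).Nonempty then
    (Finset.univ.filter fun k => (u : ℝ) < ∑ j ∈ Finset.Iic k, (p j).toReal).min' hne
  else 0

/-- A sample point: the table of rewards, `ω.1 (k, s)` being the reward of the `(s+1)`-th pull of
arm `k`, and the seeds, `ω.2 t` being used to randomize the decision of round `t + 1`. -/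
abbrev Sample (K : ℕ) : Type := (Fin K × ℕ → unitInterval) × (ℕ → unitInterval)

/-- The law under `θ`: all rewards and seeds are independent, the rewards of arm `k` are
distributed as `θ k`, and the seeds are uniform on `[0,1]`. -/
def law {K : ℕ} (θ : Env K) : Measure (Sample K) :=
  (Measure.infinitePi fun i : Fin K × ℕ => (θ i.1 : Measure unitInterval)).prod
    (Measure.infinitePi fun _ : ℕ => (volume : Measure unitInterval))

/-- The history of the first `t` rounds when the policy `σ` is played. -/
def run {K : ℕ} [NeZero K] (σ : Policy K) (ω : Sample K) : ∀ t : ℕ, History K t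
  | 0 => Fin.elim0
  | t + 1 =>
    let h : History K t := run σ ω t
    let k : Fin K := draw (σ.choice t h) (ω.2 t)
    Fin.snoc (α := fun _ => Fin K × unitInterval) h (k, ω.1 (k, pulls h k))

/-- The mean reward of arm `k`. -/
def mean {K : ℕ} (θ : Env K) (k : Fin K) : ℝ :=
  ∫ x : unitInterval, (x : ℝ) ∂(θ k : Measure unitInterval)

/-- A fixed arm with maximal mean reward. -/
def bestArm {K : ℕ} [NeZero K] (θ : Env K) : Fin K :=
  (Finite.exists_max (mean θ)).choose

/-- The optimality gap of arm `k`. -/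
def gap {K : ℕ} [NeZero K] (θ : Env K) (k : Fin K) : ℝ :=
  mean θ (bestArm θ) - mean θ k

/-- The regret after `n` rounds: the sum of the first `n` rewards of the best arm minus the sum of
the rewards received by the policy. -/
def regret {K : ℕ} [NeZero K] (σ : Policy K) (θ : Env K) (n : ℕ) (ω : Sample K) : ℝ :=
  ∑ t ∈ Finset.range n, (ω.1 (bestArm θ, t) : ℝ) - ∑ i : Fin n, ((run σ ω n i).2 : ℝ)

/-- The expected regret after `n` rounds. -/
def expRegret {K : ℕ} [NeZero K] (σ : Policy K) (θ : Env K) (n : ℕ) : ℝ :=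
  ∫ ω, regret σ θ n ω ∂(law θ)

/-- `σ` is `α`-consistent on the set of environments `Θ`. -/
def IsConsistent {K : ℕ} [NeZero K] (α : ℝ) (Θ : Set (Env K)) (σ : Policy K) : Prop :=
  ∀ a > α, ∀ θ ∈ Θ, (fun n : ℕ => expRegret σ θ n) =o[atTop] fun n : ℕ => (n : ℝ) ^ a

end

end Bandit

/-! A reward is independent of the decision that reveals it, so the expected regret is the sum over
arms of gap times expected number of pulls (`expRegret_eq`).

Upper bound. Once a suboptimal arm has `4ρ log n / Δ²` pulls, its bonus is at most `Δ/2`. It is then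
drawn at round `t` only if, for some `s ≤ t`, its first `s` samples overshoot their mean, or those
of the best arm undershoot theirs, by a total of `√(ρ s log t)` (`mem_dev_of_arm_eq`). Cutting the
range of `s` along powers of `β` and applying a maximal Hoeffding inequality to each piece bounds
such an event by `(log t / log(1/β) + 1) t^(-2ρβ)` (`measureReal_exists_sqrt_le_sum_le`). Summing
over `t` gives `n^(1-2ρβ)`, and `β` close to `1` gives consistency.

Lower bound. Let arm `0` be a fair coin and let every other arm pay the constant `c = 1/2 - δ²`.
After `s ≈ (ρ/δ²) log n` tosses the bonus of the coin is at most `δ` up to round `n`. If the mean of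
these tosses is below `c - δ`, the coin's index stays below `c`, while a constant arm's index is at
least `c`; the coin is abandoned (`pulls_zero_le`) and at least `n - s` rounds cost `δ²` each. Near
its center the binomial law attains Hoeffding's exponent, so this bad start has probability about
`exp(-2sδ²) = n^(-2ρ)`, up to a factor `1 + O(δ)` in the exponent and a logarithm
(`exp_neg_div_le_choose_div_two_pow`). A small `δ` brings the loss below `ε`. -/

namespace Bandit

/-! ### Pull counts, sampling of arms, and measurability of the run -/

variable {K : ℕ} [NeZero K]

/-- The arm drawn at round `t + 1`. -/
noncomputable def arm (σ : Policy K) (ω : Sample K) (t : ℕ) : Fin K :=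
  draw (σ.choice t (run σ ω t)) (ω.2 t)

theorem run_succ (σ : Policy K) (ω : Sample K) (t : ℕ) :
    run σ ω (t + 1) = Fin.snoc (α := fun _ => Fin K × unitInterval) (run σ ω t)
      (arm σ ω t, ω.1 (arm σ ω t, pulls (run σ ω t) (arm σ ω t))) :=
  rfl

theorem pulls_eq_sum {K : ℕ} {t : ℕ} (h : History K t) (k : Fin K) :
    pulls h k = ∑ i, if (h i).1 = k then 1 else 0 := by
  rw [pulls, Finset.card_filter]

theorem pulls_snoc {K : ℕ} {t : ℕ} (h : History K t) (x : Fin K × unitInterval) (k : Fin K) :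
    pulls (Fin.snoc (α := fun _ => Fin K × unitInterval) h x : History K (t + 1)) k =
      pulls h k + if x.1 = k then 1 else 0 := by
  rw [pulls_eq_sum, pulls_eq_sum, Fin.sum_univ_castSucc]
  simp only [Fin.snoc_castSucc, Fin.snoc_last]

theorem pulls_run_succ (σ : Policy K) (ω : Sample K) (t : ℕ) (k : Fin K) :
    pulls (run σ ω (t + 1)) k = pulls (run σ ω t) k + if arm σ ω t = k then 1 else 0 := by
  rw [run_succ, pulls_snoc]

theorem pulls_run_zero (σ : Policy K) (ω : Sample K) (k : Fin K) : pulls (run σ ω 0) k = 0 := by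
  simp [pulls_eq_sum]

theorem pulls_run_eq_sum (σ : Policy K) (ω : Sample K) (n : ℕ) (k : Fin K) :
    pulls (run σ ω n) k = ∑ t ∈ Finset.range n, if arm σ ω t = k then 1 else 0 := by
  induction n with
  | zero => simp [pulls_run_zero]
  | succ n ih => rw [pulls_run_succ, ih, Finset.sum_range_succ]

theorem pulls_le {K : ℕ} {t : ℕ} (h : History K t) (k : Fin K) : pulls h k ≤ t := by
  simpa [pulls] using Finset.card_le_univ (Finset.univ.filter fun i => (h i).1 = k)

theorem sum_pulls {K : ℕ} {t : ℕ} (h : History K t) : ∑ k, pulls h k = t := by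
  simp only [pulls_eq_sum]
  rw [Finset.sum_comm]
  simp

theorem monotone_pulls_run (σ : Policy K) (ω : Sample K) (k : Fin K) :
    Monotone fun t => pulls (run σ ω t) k :=
  monotone_nat_of_le_succ fun t => by simp [pulls_run_succ]

/-- The rewards received from arm `k` are the first entries of its row of the reward table. -/
theorem sum_rewards_run (σ : Policy K) (ω : Sample K) (t : ℕ) (k : Fin K) :
    ∑ i ∈ Finset.univ.filter (fun i => (run σ ω t i).1 = k), ((run σ ω t i).2 : ℝ) =
      ∑ s ∈ Finset.range (pulls (run σ ω t) k), (ω.1 (k, s) : ℝ) := by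
  induction t with
  | zero => simp [pulls_run_zero]
  | succ t ih =>
    rw [Finset.sum_filter] at ih ⊢
    rw [Fin.sum_univ_castSucc, pulls_run_succ]
    simp only [run_succ, Fin.snoc_castSucc, Fin.snoc_last, ih]
    split_ifs with h
    · rw [Finset.sum_range_succ, h]
    · simp

theorem empMean_run (σ : Policy K) (ω : Sample K) (t : ℕ) (k : Fin K) :
    empMean (run σ ω t) k =
      (∑ s ∈ Finset.range (pulls (run σ ω t) k), (ω.1 (k, s) : ℝ)) / pulls (run σ ω t) k := by
  rw [empMean, sum_rewards_run]

theorem sum_all_rewards_run (σ : Policy K) (ω : Sample K) (n : ℕ) :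
    ∑ i, ((run σ ω n i).2 : ℝ) =
      ∑ t ∈ Finset.range n, (ω.1 (arm σ ω t, pulls (run σ ω t) (arm σ ω t)) : ℝ) := by
  induction n with
  | zero => simp
  | succ n ih =>
    rw [Fin.sum_univ_castSucc, Finset.sum_range_succ]
    simp only [run_succ, Fin.snoc_castSucc, Fin.snoc_last, ih]

theorem measurable_pulls {K : ℕ} (t : ℕ) (k : Fin K) : Measurable fun h : History K t => pulls h k := by
  simp only [pulls_eq_sum]
  refine Finset.measurable_sum _ fun i _ => ?_
  refine Measurable.ite ?_ measurable_const measurable_const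
  exact (measurable_fst.comp (measurable_pi_apply i)) (measurableSet_singleton k)

/-- Exhibits each fibre of `draw` as a Boolean combination of comparisons, from which measurability
follows. The second alternative is the default value. -/
theorem draw_eq_iff (p : PMF (Fin K)) (u : unitInterval) (k : Fin K) :
    draw p u = k ↔
      ((u : ℝ) < ∑ j ∈ Finset.Iic k, (p j).toReal ∧
        ∀ l < k, ¬ (u : ℝ) < ∑ j ∈ Finset.Iic l, (p j).toReal) ∨
      (k = 0 ∧ ∀ l, ¬ (u : ℝ) < ∑ j ∈ Finset.Iic l, (p j).toReal) := by
  classical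
  unfold draw
  split_ifs with hne
  · rw [Finset.min'_eq_iff]
    obtain ⟨l, hl⟩ := hne
    simp only [Finset.mem_filter, Finset.mem_univ, true_and] at hl ⊢
    constructor
    · rintro ⟨h1, h2⟩
      exact Or.inl ⟨h1, fun l hlk hl => absurd (h2 l hl) (not_le.2 hlk)⟩
    · rintro (⟨h1, h2⟩ | ⟨-, h2⟩)
      · exact ⟨h1, fun l hl => not_lt.1 fun hlk => h2 l hlk hl⟩
      · exact absurd hl (h2 l)
  · rw [Finset.not_nonempty_iff_eq_empty, Finset.filter_eq_empty_iff] at hne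
    have hne' : ∀ l, ¬ (u : ℝ) < ∑ j ∈ Finset.Iic l, (p j).toReal := fun l =>
      hne (Finset.mem_univ l)
    constructor
    · rintro rfl
      exact Or.inr ⟨rfl, hne'⟩
    · rintro (⟨h1, -⟩ | ⟨h1, -⟩)
      · exact absurd h1 (hne' k)
      · exact h1.symm

/-- The partial sums pass `u` for the first time at the selected arm, which therefore has positive
mass. The total mass is `1`, so `u < 1` excludes the default value. -/
theorem draw_mem_support (p : PMF (Fin K)) {u : unitInterval} (hu : (u : ℝ) < 1) :
    draw p u ∈ p.support := by
  set k := draw p u with hk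
  have hsum : ∑ j, (p j).toReal = 1 := by
    rw [← ENNReal.toReal_sum fun j _ => p.apply_ne_top j, ← tsum_fintype (L := .unconditional _), p.tsum_coe]
    simp
  rw [PMF.mem_support_iff]
  intro h0
  rcases (draw_eq_iff p u k).1 hk.symm with ⟨h1, h2⟩ | ⟨-, h2⟩
  · rcases Nat.eq_zero_or_pos k.1 with hz | hpos
    · have : Finset.Iic k = {k} := by
        ext j
        simp only [Finset.mem_Iic, Finset.mem_singleton, Fin.le_def, Fin.ext_iff]
        omega
      rw [this, Finset.sum_singleton, h0] at h1
      exact absurd h1 (by simpa using u.2.1)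
    · have hlt : k.1 - 1 < K := by omega
      refine h2 ⟨k.1 - 1, hlt⟩ (by rw [Fin.lt_def]; simp only; omega) (h1.trans_eq ?_)
      have : Finset.Iic k = insert k (Finset.Iic ⟨k.1 - 1, hlt⟩) := by
        ext j
        simp only [Finset.mem_Iic, Finset.mem_insert, Fin.le_def, Fin.ext_iff]
        omega
      rw [this, Finset.sum_insert, h0]
      · simp
      · simp only [Finset.mem_Iic, Fin.le_def]
        omega
  · have hpos := NeZero.pos K
    refine h2 ⟨K - 1, by omega⟩ (hu.trans_eq ?_)
    rw [← hsum]
    refine (Finset.sum_congr ?_ fun _ _ => rfl).symm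
    ext j
    have := j.2
    simp only [Finset.mem_Iic, Finset.mem_univ, Fin.le_def, iff_true]
    omega

theorem measurable_draw {α : Type*} [MeasurableSpace α] {p : α → PMF (Fin K)}
    {u : α → unitInterval} (hp : ∀ k, Measurable fun x => p x k) (hu : Measurable u) :
    Measurable fun x => draw (p x) (u x) := by
  have hlt : ∀ k : Fin K,
      MeasurableSet {x | (u x : ℝ) < ∑ j ∈ Finset.Iic k, (p x j).toReal} := fun k =>
    measurableSet_lt (measurable_subtype_coe.comp hu)
      (Finset.measurable_sum _ fun j _ => (hp j).ennreal_toReal)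
  refine measurable_to_countable' fun k => ?_
  have : (fun x => draw (p x) (u x)) ⁻¹' {k} =
      {x | (u x : ℝ) < ∑ j ∈ Finset.Iic k, (p x j).toReal} ∩
        (⋂ l, ⋂ (_ : l < k), {x | (u x : ℝ) < ∑ j ∈ Finset.Iic l, (p x j).toReal}ᶜ) ∪
      {_x | k = 0} ∩ ⋂ l, {x | (u x : ℝ) < ∑ j ∈ Finset.Iic l, (p x j).toReal}ᶜ := by
    ext x
    simp [draw_eq_iff]
  rw [this]
  exact ((hlt k).inter (.iInter fun l => .iInter fun _ => (hlt l).compl)).union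
    ((MeasurableSet.const _).inter (.iInter fun l => (hlt l).compl))

theorem measurable_arm_of_run (σ : Policy K) {t : ℕ} (h : Measurable fun ω => run σ ω t) :
    Measurable fun ω => arm σ ω t :=
  measurable_draw (fun k => (σ.measurable_choice t k).comp h)
    ((measurable_pi_apply t).comp measurable_snd)

/-- The index ranges over a countable set, so evaluation is jointly measurable in the table and the
index. -/
theorem measurable_reward_entry {K : ℕ} {i : Sample K → Fin K × ℕ} (hi : Measurable i) :
    Measurable fun ω : Sample K => ω.1 (i ω) := by
  have h : Measurable fun q : Sample K × (Fin K × ℕ) => q.1.1 q.2 :=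
    measurable_from_prod_countable_left fun j => (measurable_pi_apply j).comp measurable_fst
  exact h.comp (measurable_id.prodMk hi)

theorem measurable_pulls_arm {K : ℕ} {t : ℕ} {h : Sample K → History K t} {k : Sample K → Fin K}
    (hh : Measurable h) (hk : Measurable k) : Measurable fun ω => pulls (h ω) (k ω) := by
  have hm : Measurable fun q : History K t × Fin K => pulls q.1 q.2 :=
    measurable_from_prod_countable_left fun j => measurable_pulls t j
  exact hm.comp (hh.prodMk hk)

theorem measurable_run (σ : Policy K) (t : ℕ) : Measurable fun ω => run σ ω t := by
  induction t with
  | zero => exact measurable_pi_lambda _ fun i => i.elim0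
  | succ t ih =>
    have ha := measurable_arm_of_run σ ih
    refine measurable_pi_lambda _ fun i => ?_
    refine Fin.lastCases ?_ (fun i => ?_) i
    · simp only [run_succ, Fin.snoc_last]
      exact ha.prodMk (measurable_reward_entry (ha.prodMk (measurable_pulls_arm ih ha)))
    · simp only [run_succ, Fin.snoc_castSucc]
      exact (measurable_pi_apply i).comp ih

theorem measurable_arm (σ : Policy K) (t : ℕ) : Measurable fun ω => arm σ ω t :=
  measurable_arm_of_run σ (measurable_run σ t)

theorem measurable_pulls_run (σ : Policy K) (t : ℕ) (k : Fin K) :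
    Measurable fun ω => pulls (run σ ω t) k :=
  (measurable_pulls t k).comp (measurable_run σ t)

instance isProbabilityMeasure_law {K : ℕ} (θ : Env K) : IsProbabilityMeasure (law θ) := by
  unfold law
  infer_instance

/-- Almost surely, every arm drawn belongs to the support of the decision of the policy. -/
theorem ae_arm_mem_support (σ : Policy K) (θ : Env K) :
    ∀ᵐ ω ∂law θ, ∀ t, arm σ ω t ∈ (σ.choice t (run σ ω t)).support := by
  have hseed : ∀ᵐ ω ∂law θ, ∀ t, ((ω.2 t : unitInterval) : ℝ) < 1 := by
    rw [ae_all_iff]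
    intro t
    have hmp : MeasurePreserving (fun ω : Sample K => ω.2 t) (law θ) volume :=
      (measurePreserving_eval_infinitePi (fun _ : ℕ => (volume : Measure unitInterval)) t).comp
        measurePreserving_snd
    have hone : ∀ᵐ u : unitInterval, u ≠ 1 := by
      rw [ae_iff]
      simp
    filter_upwards [hmp.quasiMeasurePreserving.ae hone] with ω hω
    exact lt_of_le_of_ne (ω.2 t).2.2 fun h => hω (Subtype.ext h)
  filter_upwards [hseed] with ω hω t
  exact draw_mem_support _ (hω t)

end Bandit

/-! ### Resampling one coordinate of an infinite product -/

section InfinitePi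

variable {ι : Type*} [DecidableEq ι] {X : ι → Type*} [∀ i, MeasurableSpace (X i)]
  (μ : ∀ i, Measure (X i)) [∀ i, IsProbabilityMeasure (μ i)]

/-- Resampling one coordinate preserves a product of probability measures. -/
theorem measurePreserving_update_infinitePi (i : ι) :
    MeasurePreserving (fun q : (∀ j, X j) × X i => Function.update q.1 i q.2)
      ((Measure.infinitePi μ).prod (μ i)) (Measure.infinitePi μ) := by
  have hm : Measurable fun q : (∀ j, X j) × X i => Function.update q.1 i q.2 := by
    refine measurable_pi_lambda _ fun j => ?_
    by_cases hj : j = i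
    · subst hj
      simpa using measurable_snd
    · simp only [Function.update_of_ne hj]
      exact (measurable_pi_apply j).comp measurable_fst
  refine ⟨hm, Measure.eq_infinitePi _ fun s t ht => ?_⟩
  rw [Measure.map_apply hm (MeasurableSet.pi s.countable_toSet fun j _ => ht j)]
  by_cases hi : i ∈ s
  · have : (fun q : (∀ j, X j) × X i => Function.update q.1 i q.2) ⁻¹' Set.pi s t =
        Set.pi (s.erase i : Finset ι) t ×ˢ t i := by
      ext q
      simp only [Set.mem_preimage, Set.mem_pi, Finset.mem_coe, Set.mem_prod, Finset.mem_erase]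
      constructor
      · intro h
        exact ⟨fun j hj => by simpa [hj.1] using h j hj.2, by simpa using h i hi⟩
      · rintro ⟨h1, h2⟩ j hj
        by_cases hji : j = i
        · subst hji
          simpa using h2
        · simpa [hji] using h1 j ⟨hji, hj⟩
    rw [this, Measure.prod_prod, Measure.infinitePi_pi _ fun j _ => ht j,
      Finset.prod_erase_mul _ _ hi]
  · have : (fun q : (∀ j, X j) × X i => Function.update q.1 i q.2) ⁻¹' Set.pi s t =
        Set.pi s t ×ˢ Set.univ := by
      ext q
      simp only [Set.mem_preimage, Set.mem_pi, Finset.mem_coe, Set.mem_prod, Set.mem_univ,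
        and_true]
      refine forall₂_congr fun j hj => ?_
      rw [Function.update_of_ne (ne_of_mem_of_not_mem hj hi)]
    rw [this, Measure.prod_prod, Measure.infinitePi_pi _ fun j _ => ht j, measure_univ, mul_one]

/-- A function that does not depend on one coordinate is independent of this coordinate. -/
theorem integral_mul_eval_infinitePi (i : ι) {f : (∀ j, X j) → ℝ} (hf : Measurable f)
    (hinv : ∀ x v, f (Function.update x i v) = f x) {g : X i → ℝ} (hg : Measurable g) :
    ∫ x, f x * g (x i) ∂Measure.infinitePi μ =
      (∫ x, f x ∂Measure.infinitePi μ) * ∫ v, g v ∂μ i := by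
  have hmp := measurePreserving_update_infinitePi μ i
  conv_lhs => rw [← hmp.map_eq]
  have hfg : Measurable fun x : ∀ j, X j => f x * g (x i) :=
    hf.mul (hg.comp (measurable_pi_apply i))
  rw [integral_map hmp.measurable.aemeasurable hfg.aestronglyMeasurable]
  simp only [hinv, Function.update_self]
  exact integral_prod_mul f g

end InfinitePi

/-! ### Independence of decisions and revealed rewards; decomposition of the regret -/

namespace Bandit

variable {K : ℕ} [NeZero K]

/-- The history does not depend on the rewards that were not revealed. -/
theorem run_update (σ : Policy K) (x : Fin K × ℕ → unitInterval) (y : ℕ → unitInterval)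
    (k : Fin K) (s : ℕ) (v : unitInterval) (t : ℕ) (h : pulls (run σ (x, y) t) k ≤ s) :
    run σ (Function.update x (k, s) v, y) t = run σ (x, y) t := by
  induction t with
  | zero => rfl
  | succ t ih =>
    have ht := ih ((monotone_pulls_run σ (x, y) k t.le_succ).trans h)
    have ha : arm σ (Function.update x (k, s) v, y) t = arm σ (x, y) t := by
      simp only [arm, ht]
    rw [run_succ, run_succ, ha, ht]
    congr 2
    -- Reading the entry `(k, s)` in this round would raise the pull count of `k` to `s + 1`,
    -- against `h`.
    refine Function.update_of_ne (fun heq => ?_) _ _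
    rw [Prod.mk.injEq] at heq
    rw [pulls_run_succ, if_pos heq.1] at h
    rw [heq.1] at heq
    omega

/-- The event is decided before the entry `(k, s)` is revealed. One implication suffices, because
writing back the old value undoes the update. -/
theorem arm_eq_and_pulls_eq_update (σ : Policy K) (x : Fin K × ℕ → unitInterval)
    (y : ℕ → unitInterval) (k : Fin K) (s : ℕ) (v : unitInterval) (t : ℕ) :
    (arm σ (Function.update x (k, s) v, y) t = k ∧
      pulls (run σ (Function.update x (k, s) v, y) t) k = s) ↔
    (arm σ (x, y) t = k ∧ pulls (run σ (x, y) t) k = s) := by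
  have key : ∀ (x : Fin K × ℕ → unitInterval) (v : unitInterval),
      (arm σ (x, y) t = k ∧ pulls (run σ (x, y) t) k = s) →
      (arm σ (Function.update x (k, s) v, y) t = k ∧
        pulls (run σ (Function.update x (k, s) v, y) t) k = s) := by
    rintro x v ⟨h1, h2⟩
    have hr := run_update σ x y k s v t h2.le
    refine ⟨?_, by rw [hr, h2]⟩
    refine Eq.trans ?_ h1
    simp only [arm, hr]
  refine ⟨fun h => ?_, key x v⟩
  simpa using key _ (x (k, s)) h

theorem measurableSet_arm_pulls (σ : Policy K) (k : Fin K) (s t : ℕ) :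
    MeasurableSet {ω | arm σ ω t = k ∧ pulls (run σ ω t) k = s} :=
  (measurable_arm σ t (measurableSet_singleton k)).inter
    (measurable_pulls_run σ t k (measurableSet_singleton s))

theorem measurable_reward {K : ℕ} (i : Fin K × ℕ) :
    Measurable fun ω : Sample K => (ω.1 i : ℝ) :=
  measurable_subtype_coe.comp ((measurable_pi_apply i).comp measurable_fst)

theorem integrable_of_abs_le {Ω : Type*} [MeasurableSpace Ω] {μ : Measure Ω} [IsFiniteMeasure μ]
    {f : Ω → ℝ} (hf : Measurable f) {C : ℝ} (hC : ∀ ω, |f ω| ≤ C) : Integrable f μ :=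
  Integrable.of_bound hf.aestronglyMeasurable C (Eventually.of_forall hC)

theorem integrable_reward {K : ℕ} (θ : Env K) (i : Fin K × ℕ) :
    Integrable (fun ω : Sample K => (ω.1 i : ℝ)) (law θ) :=
  integrable_of_abs_le (measurable_reward i) (C := 1) fun ω => by
    rw [abs_of_nonneg (ω.1 i).2.1]
    exact (ω.1 i).2.2

theorem measurePreserving_reward {K : ℕ} (θ : Env K) (i : Fin K × ℕ) :
    MeasurePreserving (fun ω : Sample K => ω.1 i) (law θ) (θ i.1 : Measure unitInterval) :=
  (measurePreserving_eval_infinitePi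
    (fun i : Fin K × ℕ => (θ i.1 : Measure unitInterval)) i).comp measurePreserving_fst

theorem integral_reward {K : ℕ} (θ : Env K) (i : Fin K × ℕ) :
    ∫ ω : Sample K, (ω.1 i : ℝ) ∂law θ = mean θ i.1 := by
  have hmp := measurePreserving_reward θ i
  rw [mean, ← hmp.map_eq, integral_map hmp.measurable.aemeasurable]
  exact measurable_subtype_coe.aestronglyMeasurable

/-- The reward revealed at a pull is independent of the decision to make this pull. -/
theorem integral_indicator_mul_reward (σ : Policy K) (θ : Env K) (k : Fin K) (s t : ℕ) :
    ∫ ω, (if arm σ ω t = k ∧ pulls (run σ ω t) k = s then (1 : ℝ) else 0) * (ω.1 (k, s) : ℝ)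
        ∂law θ =
      (∫ ω, (if arm σ ω t = k ∧ pulls (run σ ω t) k = s then (1 : ℝ) else 0) ∂law θ) *
        mean θ k := by
  have hm : Measurable fun ω : Sample K =>
      (if arm σ ω t = k ∧ pulls (run σ ω t) k = s then (1 : ℝ) else 0) :=
    Measurable.ite (measurableSet_arm_pulls σ k s t) measurable_const measurable_const
  have hb : ∀ ω : Sample K,
      |(if arm σ ω t = k ∧ pulls (run σ ω t) k = s then (1 : ℝ) else 0)| ≤ 1 := fun ω => by
    split_ifs <;> simp
  have hi1 := integrable_of_abs_le (μ := law θ) hm hb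
  have hi2 := integrable_of_abs_le (μ := law θ) (hm.mul (measurable_reward (k, s))) (C := 1)
    fun ω => by
      rw [Pi.mul_apply, abs_mul, abs_of_nonneg (ω.1 (k, s)).2.1]
      exact mul_le_one₀ (hb ω) (ω.1 (k, s)).2.1 (ω.1 (k, s)).2.2
  simp only [Pi.mul_def] at hi2
  unfold law at hi1 hi2 ⊢
  -- With the seeds frozen, the decision is a function of the reward table alone, and resampling the
  -- entry `(k, s)` applies.
  rw [integral_prod_symm _ hi1, integral_prod_symm _ hi2, ← integral_mul_const]
  refine integral_congr_ae (Eventually.of_forall fun y => ?_)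
  have hmy : Measurable fun x : Fin K × ℕ → unitInterval =>
      (if arm σ (x, y) t = k ∧ pulls (run σ (x, y) t) k = s then (1 : ℝ) else 0) :=
    hm.comp measurable_prodMk_right
  exact integral_mul_eval_infinitePi (fun i : Fin K × ℕ => (θ i.1 : Measure unitInterval)) (k, s)
    hmy (fun x v => by simp only [arm_eq_and_pulls_eq_update]) measurable_subtype_coe

theorem integrable_indicator_arm (σ : Policy K) (θ : Env K) (k : Fin K) (t : ℕ) :
    Integrable (fun ω => if arm σ ω t = k then (1 : ℝ) else 0) (law θ) :=
  integrable_of_abs_le (Measurable.ite (measurable_arm σ t (measurableSet_singleton k))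
    measurable_const measurable_const) (C := 1) fun ω => by split_ifs <;> simp

/-- The entry being read is random; splitting over its finitely many positions (at most `t` earlier
pulls) reduces to fixed entries. -/
theorem integral_received_reward (σ : Policy K) (θ : Env K) (t : ℕ) :
    Integrable (fun ω => (ω.1 (arm σ ω t, pulls (run σ ω t) (arm σ ω t)) : ℝ)) (law θ) ∧
    ∫ ω, (ω.1 (arm σ ω t, pulls (run σ ω t) (arm σ ω t)) : ℝ) ∂law θ =
      ∑ k, (∫ ω, (if arm σ ω t = k then (1 : ℝ) else 0) ∂law θ) * mean θ k := by
  have hm : ∀ k s, Measurable fun ω : Sample K =>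
      (if arm σ ω t = k ∧ pulls (run σ ω t) k = s then (1 : ℝ) else 0) := fun k s =>
    Measurable.ite (measurableSet_arm_pulls σ k s t) measurable_const measurable_const
  have hb : ∀ k s, ∀ ω : Sample K,
      |(if arm σ ω t = k ∧ pulls (run σ ω t) k = s then (1 : ℝ) else 0)| ≤ 1 := fun k s ω => by
    split_ifs <;> simp
  have hpull : ∀ ω k, (if arm σ ω t = k then (1 : ℝ) else 0) =
      ∑ s ∈ Finset.range (t + 1),
        (if arm σ ω t = k ∧ pulls (run σ ω t) k = s then (1 : ℝ) else 0) := by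
    intro ω k
    split_ifs with h
    · simp [h, Nat.lt_succ_of_le (pulls_le (run σ ω t) k)]
    · simp [h]
  have heq : ∀ ω, (ω.1 (arm σ ω t, pulls (run σ ω t) (arm σ ω t)) : ℝ) =
      ∑ k, ∑ s ∈ Finset.range (t + 1),
        (if arm σ ω t = k ∧ pulls (run σ ω t) k = s then (1 : ℝ) else 0) * (ω.1 (k, s) : ℝ) := by
    intro ω
    rw [Finset.sum_eq_single (arm σ ω t), Finset.sum_eq_single (pulls (run σ ω t) (arm σ ω t))]
    · simp
    · intro s _ hs
      simp [hs.symm]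
    · intro hs
      exact absurd (Finset.mem_range.2 (Nat.lt_succ_of_le (pulls_le _ _))) hs
    · intro k _ hk
      simp [hk.symm]
    · simp
  have hi : ∀ k s, Integrable (fun ω : Sample K =>
      (if arm σ ω t = k ∧ pulls (run σ ω t) k = s then (1 : ℝ) else 0) * (ω.1 (k, s) : ℝ))
      (law θ) := fun k s =>
    integrable_of_abs_le ((hm k s).mul (measurable_reward (k, s))) (C := 1) fun ω => by
      rw [abs_mul, abs_of_nonneg (ω.1 (k, s)).2.1]
      exact mul_le_one₀ (hb k s ω) (ω.1 (k, s)).2.1 (ω.1 (k, s)).2.2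
  simp only [heq, hpull]
  refine ⟨integrable_finsetSum _ fun k _ => integrable_finsetSum _ fun s _ => hi k s, ?_⟩
  rw [integral_finsetSum _ fun k _ => integrable_finsetSum _ fun s _ => hi k s]
  refine Finset.sum_congr rfl fun k _ => ?_
  rw [integral_finsetSum _ fun s _ => hi k s,
    integral_finsetSum _ fun s _ => integrable_of_abs_le (hm k s) (hb k s), Finset.sum_mul]
  exact Finset.sum_congr rfl fun s _ => integral_indicator_mul_reward σ θ k s t

theorem integrable_pulls (σ : Policy K) (θ : Env K) (n : ℕ) (k : Fin K) :
    Integrable (fun ω => (pulls (run σ ω n) k : ℝ)) (law θ) :=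
  integrable_of_abs_le (measurable_from_nat.comp (measurable_pulls_run σ n k)) (C := n)
    fun ω => by
      rw [Nat.abs_cast]
      exact_mod_cast pulls_le _ _

theorem integral_pulls (σ : Policy K) (θ : Env K) (n : ℕ) (k : Fin K) :
    ∫ ω, (pulls (run σ ω n) k : ℝ) ∂law θ =
      ∑ t ∈ Finset.range n, ∫ ω, (if arm σ ω t = k then (1 : ℝ) else 0) ∂law θ := by
  rw [← integral_finsetSum _ fun t _ => integrable_indicator_arm σ θ k t]
  refine integral_congr_ae (Eventually.of_forall fun ω => ?_)
  simp [pulls_run_eq_sum]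

/-- The expected regret is the sum of the gaps weighted by the expected numbers of pulls. -/
theorem expRegret_eq (σ : Policy K) (θ : Env K) (n : ℕ) :
    expRegret σ θ n = ∑ k, gap θ k * ∫ ω, (pulls (run σ ω n) k : ℝ) ∂law θ := by
  have hone : ∀ t, ∑ k, ∫ ω, (if arm σ ω t = k then (1 : ℝ) else 0) ∂law θ = 1 := by
    intro t
    rw [← integral_finsetSum _ fun k _ => integrable_indicator_arm σ θ k t]
    simp
  unfold expRegret regret
  simp only [sum_all_rewards_run]
  rw [integral_sub (integrable_finsetSum _ fun t _ => integrable_reward θ _)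
      (integrable_finsetSum _ fun t _ => (integral_received_reward σ θ t).1),
    integral_finsetSum _ fun t _ => integrable_reward θ _,
    integral_finsetSum _ fun t _ => (integral_received_reward σ θ t).1]
  simp only [integral_reward, (integral_received_reward σ θ _).2, integral_pulls, Finset.mul_sum]
  rw [Finset.sum_comm (s := Finset.univ), ← Finset.sum_sub_distrib]
  refine Finset.sum_congr rfl fun t _ => ?_
  simp only [gap, sub_mul, Finset.sum_sub_distrib, ← Finset.mul_sum, hone, mul_one]
  simp only [mul_comm]

theorem gap_nonneg (θ : Env K) (k : Fin K) : 0 ≤ gap θ k :=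
  sub_nonneg.2 ((Finite.exists_max (mean θ)).choose_spec k)

theorem expRegret_nonneg (σ : Policy K) (θ : Env K) (n : ℕ) : 0 ≤ expRegret σ θ n := by
  rw [expRegret_eq]
  exact Finset.sum_nonneg fun k _ => mul_nonneg (gap_nonneg θ k)
    (integral_nonneg fun ω => Nat.cast_nonneg _)

end Bandit

/-! ### Maximal Hoeffding inequality and peeling -/

section MaximalInequality

open ProbabilityTheory

variable {Ω : Type*} [mΩ : MeasurableSpace Ω] {P : Measure Ω} [IsProbabilityMeasure P]
  {Y : ℕ → Ω → ℝ} {c : NNReal}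

/-- Exponentials of partial sums of independent centered variables form a submartingale. -/
theorem submartingale_exp_sum (hindep : iIndepFun Y P) (hmeas : ∀ i, Measurable (Y i))
    (hsub : ∀ i, HasSubgaussianMGF (Y i) c P) (hmean : ∀ i, ∫ ω, Y i ω ∂P = 0) (l : ℝ) :
    Submartingale (fun n ω => Real.exp (l * ∑ i ∈ Finset.range (n + 1), Y i ω))
      (Filtration.natural Y fun i => (hmeas i).stronglyMeasurable) P := by
  set F := Filtration.natural Y fun i => (hmeas i).stronglyMeasurable with hF
  have hadp : ∀ n, Measurable[F n] fun ω =>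
      Real.exp (l * ∑ i ∈ Finset.range (n + 1), Y i ω) := by
    intro n
    refine Real.measurable_exp.comp (Measurable.const_mul ?_ l)
    refine Finset.measurable_sum _ fun i hi => ?_
    exact ((Filtration.stronglyAdapted_natural fun i => (hmeas i).stronglyMeasurable) i).measurable.mono
      (F.mono (Nat.lt_succ_iff.1 (Finset.mem_range.1 hi))) le_rfl
  have hint : ∀ n, Integrable (fun ω => Real.exp (l * ∑ i ∈ Finset.range (n + 1), Y i ω)) P :=
    fun n => (HasSubgaussianMGF.sum_of_iIndepFun hindep
      (fun i (_ : i ∈ Finset.range (n + 1)) => hsub i)).integrable_exp_mul l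
  refine submartingale_of_setIntegral_le_succ (fun n => (hadp n).stronglyMeasurable) hint
    fun n s hs => ?_
  have hs' : MeasurableSet s := F.le n s hs
  set f := fun ω => Real.exp (l * ∑ i ∈ Finset.range (n + 1), Y i ω) with hf
  set g := fun ω => Real.exp (l * Y (n + 1) ω) with hg
  have hgint : Integrable g P := (hsub (n + 1)).integrable_exp_mul l
  have hfg : IndepFun (s.indicator f) g P := by
    rw [IndepFun_iff_Indep]
    refine Indep.symm (indep_of_indep_of_le_left (indep_of_indep_of_le_right
      (hindep.indep_comap_natural_of_lt (fun i => (hmeas i).stronglyMeasurable)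
        (Nat.lt_succ_self n)) ?_) ?_)
    · exact Measurable.comap_le ((hadp n).indicator hs)
    · rw [← measurable_iff_comap_le]
      exact Real.measurable_exp.comp ((comap_measurable _).const_mul l)
  -- The submartingale property rests on `exp x ≥ 1 + x` and on centering.
  have hone : 1 ≤ ∫ ω, g ω ∂P := by
    calc (1 : ℝ) = ∫ ω, (l * Y (n + 1) ω + 1) ∂P := by
          rw [integral_add ((hsub (n + 1)).integrable.const_mul l) (integrable_const _),
            integral_const_mul, hmean]
          simp
      _ ≤ _ := integral_mono (((hsub (n + 1)).integrable.const_mul l).add (integrable_const _))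
          hgint fun ω => Real.add_one_le_exp _
  have hprod : (fun ω => Real.exp (l * ∑ i ∈ Finset.range (n + 1 + 1), Y i ω)) =
      fun ω => f ω * g ω := by
    funext ω
    rw [Finset.sum_range_succ, mul_add, Real.exp_add]
  rw [hprod, ← integral_indicator hs', ← integral_indicator hs']
  have hind : s.indicator (fun ω => f ω * g ω) = s.indicator f * g := by
    funext ω
    by_cases h : ω ∈ s <;> simp [h]
  rw [hind, hfg.integral_mul_eq_mul_integral
    ((hint n).indicator hs').aestronglyMeasurable hgint.aestronglyMeasurable]
  exact le_mul_of_one_le_right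
    (integral_nonneg fun ω => Set.indicator_nonneg (fun _ _ => (Real.exp_pos _).le) _) hone

/-- Doob's maximal inequality for the exponential submartingale, followed by the subgaussian bound
at the last time. The empty sum plays no role since `ε > 0`. -/
theorem measureReal_exists_sum_ge_le_exp (hindep : iIndepFun Y P)
    (hmeas : ∀ i, Measurable (Y i))
    (hsub : ∀ i, HasSubgaussianMGF (Y i) c P) (hmean : ∀ i, ∫ ω, Y i ω ∂P = 0) {l : ℝ}
    (hl : 0 ≤ l) {ε : ℝ} (hε : 0 < ε) (m : ℕ) :
    P.real {ω | ∃ s ≤ m, ε ≤ ∑ i ∈ Finset.range s, Y i ω} ≤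
      Real.exp (m * c * l ^ 2 / 2 - l * ε) := by
  rcases m with _ | m
  · have : {ω | ∃ s ≤ 0, ε ≤ ∑ i ∈ Finset.range s, Y i ω} = ∅ := by
      ext ω
      simpa using hε
    rw [this]
    simpa using (Real.exp_pos _).le
  set f : ℕ → Ω → ℝ := fun n ω => Real.exp (l * ∑ i ∈ Finset.range (n + 1), Y i ω) with hf
  have hsm := submartingale_exp_sum hindep hmeas hsub hmean l
  have hmax := maximal_ineq hsm (fun n ω => (Real.exp_pos _).le)
    (ε := ⟨Real.exp (l * ε), (Real.exp_pos _).le⟩) m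
  set A := {ω | ((⟨Real.exp (l * ε), (Real.exp_pos _).le⟩ : NNReal) : ℝ) ≤
    (Finset.range (m + 1)).sup' Finset.nonempty_range_add_one fun k => f k ω} with hA
  have hle : ∫ ω in A, f m ω ∂P ≤ Real.exp ((m + 1 : ℕ) * c * l ^ 2 / 2) := by
    refine (setIntegral_le_integral (hsm.integrable m)
      (Eventually.of_forall fun ω => (Real.exp_pos _).le)).trans ?_
    have := (HasSubgaussianMGF.sum_of_iIndepFun hindep
      (fun i (_ : i ∈ Finset.range (m + 1)) => hsub i)).mgf_le l
    simpa [mgf] using this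
  have hreal : Real.exp (l * ε) * P.real A ≤ Real.exp ((m + 1 : ℕ) * c * l ^ 2 / 2) := by
    have := ENNReal.toReal_mono ENNReal.ofReal_ne_top
      (hmax.trans (ENNReal.ofReal_le_ofReal hle))
    rw [ENNReal.toReal_mul, ENNReal.toReal_ofReal (Real.exp_pos _).le] at this
    exact this
  have hsubset : {ω | ∃ s ≤ m + 1, ε ≤ ∑ i ∈ Finset.range s, Y i ω} ⊆ A := by
    rintro ω ⟨s, hs, hεs⟩
    rcases s with _ | s
    · simp only [Finset.range_zero, Finset.sum_empty] at hεs
      exact absurd hεs (not_le.2 hε)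
    · rw [hA, Set.mem_ofPred_eq, Finset.le_sup'_iff]
      refine ⟨s, Finset.mem_range.2 hs, ?_⟩
      exact Real.exp_le_exp.2 (mul_le_mul_of_nonneg_left hεs hl)
  calc P.real {ω | ∃ s ≤ m + 1, ε ≤ ∑ i ∈ Finset.range s, Y i ω} ≤ P.real A :=
        measureReal_mono hsubset
    _ ≤ Real.exp ((m + 1 : ℕ) * c * l ^ 2 / 2) / Real.exp (l * ε) := by
        rw [le_div_iff₀ (Real.exp_pos _), mul_comm]
        exact hreal
    _ = _ := (Real.exp_sub _ _).symm

/-- The maximal form of Hoeffding's inequality. -/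
theorem measureReal_exists_sum_ge_le (hindep : iIndepFun Y P) (hmeas : ∀ i, Measurable (Y i))
    (hsub : ∀ i, HasSubgaussianMGF (Y i) c P) (hmean : ∀ i, ∫ ω, Y i ω ∂P = 0) (hc : 0 < c)
    {ε : ℝ} (hε : 0 < ε) {M : ℝ} (hM : 0 < M) :
    P.real {ω | ∃ s : ℕ, (s : ℝ) ≤ M ∧ ε ≤ ∑ i ∈ Finset.range s, Y i ω} ≤
      Real.exp (-ε ^ 2 / (2 * M * c)) := by
  have hc' : (0 : ℝ) < c := hc
  have hset : {ω | ∃ s : ℕ, (s : ℝ) ≤ M ∧ ε ≤ ∑ i ∈ Finset.range s, Y i ω} =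
      {ω | ∃ s ≤ ⌊M⌋₊, ε ≤ ∑ i ∈ Finset.range s, Y i ω} := by
    simp only [Nat.le_floor_iff hM.le]
  rw [hset]
  -- This `l` minimizes `M c l² / 2 - l ε`.
  refine (measureReal_exists_sum_ge_le_exp hindep hmeas hsub hmean
    (l := ε / (M * c)) (by positivity) hε _).trans (Real.exp_le_exp.2 ?_)
  have hfl : (⌊M⌋₊ : ℝ) ≤ M := Nat.floor_le hM.le
  calc (⌊M⌋₊ : ℝ) * c * (ε / (M * c)) ^ 2 / 2 - ε / (M * c) * ε
      ≤ M * c * (ε / (M * c)) ^ 2 / 2 - ε / (M * c) * ε := by gcongr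
    _ = -ε ^ 2 / (2 * M * c) := by field_simp; ring

/-- A deviation bound for partial sums, uniform in the number of terms, obtained by applying the
maximal inequality on a geometric grid. -/
theorem measureReal_exists_sqrt_le_sum_le (hindep : iIndepFun Y P)
    (hmeas : ∀ i, Measurable (Y i)) (hsub : ∀ i, HasSubgaussianMGF (Y i) (1 / 4) P)
    (hmean : ∀ i, ∫ ω, Y i ω ∂P = 0) {ρ β : ℝ} (hρ : 0 < ρ) (hβ0 : 0 < β) (hβ1 : β < 1)
    {t : ℕ} (ht : 2 ≤ t) :
    P.real {ω | ∃ s, 1 ≤ s ∧ s ≤ t ∧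
        Real.sqrt (ρ * s * Real.log t) ≤ ∑ i ∈ Finset.range s, Y i ω} ≤
      (Real.log t / Real.log (1 / β) + 1) * (t : ℝ) ^ (-(2 * ρ * β)) := by
  have ht0 : (0 : ℝ) < t := by positivity
  have hlog : 0 < Real.log t := Real.log_pos (by exact_mod_cast ht)
  have hlb : 0 < Real.log (1 / β) := Real.log_pos (by rw [one_div]; exact (one_lt_inv₀ hβ0).2 hβ1)
  set N := ⌊Real.log t / Real.log (1 / β)⌋₊ with hN
  -- `E j` handles `β^(j+1) t < s ≤ β^j t`: the threshold is taken at the lower end and the number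
  -- of terms at the upper end, whence the factor `β` in the exponent. Since `s ≥ 1`, only `j ≤ N`
  -- occur.
  set E : ℕ → Set Ω := fun j => {ω | ∃ s : ℕ, (s : ℝ) ≤ β ^ j * t ∧
    Real.sqrt (ρ * (β ^ (j + 1) * t) * Real.log t) ≤ ∑ i ∈ Finset.range s, Y i ω} with hE
  have hE_le : ∀ j, P.real (E j) ≤ (t : ℝ) ^ (-(2 * ρ * β)) := by
    intro j
    refine (measureReal_exists_sum_ge_le hindep hmeas hsub hmean (by norm_num)
      (Real.sqrt_pos.2 (by positivity)) (by positivity)).trans_eq ?_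
    rw [Real.sq_sqrt (by positivity), Real.rpow_def_of_pos ht0]
    congr 1
    push_cast
    field_simp
    ring
  have hsubset : {ω | ∃ s, 1 ≤ s ∧ s ≤ t ∧
      Real.sqrt (ρ * s * Real.log t) ≤ ∑ i ∈ Finset.range s, Y i ω} ⊆
      ⋃ j ∈ Finset.range (N + 1), E j := by
    rintro ω ⟨s, hs1, hst, hs⟩
    have hs0 : (0 : ℝ) < s := by exact_mod_cast hs1
    obtain ⟨j, hj1, hj2⟩ := exists_nat_pow_near_of_lt_one (x := (s : ℝ) / t) (y := β)
      (by positivity) ((div_le_one ht0).2 (by exact_mod_cast hst)) hβ0 hβ1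
    rw [lt_div_iff₀ ht0] at hj1
    rw [div_le_iff₀ ht0] at hj2
    refine Set.mem_biUnion (x := j) ?_ ⟨s, hj2, le_trans (Real.sqrt_le_sqrt ?_) hs⟩
    · rw [Finset.mem_coe, Finset.mem_range, Nat.lt_succ_iff, hN, Nat.le_floor_iff (by positivity),
        le_div_iff₀ hlb]
      have h1 : (1 : ℝ) ≤ β ^ j * t := le_trans (by exact_mod_cast hs1) hj2
      have h2 := Real.log_nonneg h1
      rw [Real.log_mul (by positivity) ht0.ne', Real.log_pow] at h2
      rw [one_div, Real.log_inv]
      linarith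
    · gcongr
  calc _ ≤ P.real (⋃ j ∈ Finset.range (N + 1), E j) := measureReal_mono hsubset (measure_ne_top _ _)
    _ ≤ ∑ j ∈ Finset.range (N + 1), P.real (E j) := measureReal_biUnion_finset_le _ _
    _ ≤ ∑ j ∈ Finset.range (N + 1), (t : ℝ) ^ (-(2 * ρ * β)) :=
        Finset.sum_le_sum fun j _ => hE_le j
    _ = ((N : ℝ) + 1) * (t : ℝ) ^ (-(2 * ρ * β)) := by simp
    _ ≤ _ := by
        gcongr
        exact Nat.floor_le (by positivity)

end MaximalInequality

/-! ### Deviations of the arms and the upper bound on the regret -/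

namespace Bandit

open ProbabilityTheory

theorem iIndepFun_reward {K : ℕ} (θ : Env K) :
    iIndepFun (fun (i : Fin K × ℕ) (ω : Sample K) => ω.1 i) (law θ) := by
  have hm : ∀ i : Fin K × ℕ, Measurable fun ω : Sample K => ω.1 i := fun i =>
    (measurable_pi_apply i).comp measurable_fst
  rw [iIndepFun_iff_map_fun_eq_infinitePi_map hm]
  simp only [(measurePreserving_reward θ _).map_eq]
  exact (measurePreserving_fst : MeasurePreserving Prod.fst (law θ) _).map_eq

theorem iIndepFun_reward_sub {K : ℕ} (θ : Env K) (k : Fin K) :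
    iIndepFun (fun (s : ℕ) (ω : Sample K) => (ω.1 (k, s) : ℝ) - mean θ k) (law θ) :=
  ((iIndepFun_reward θ).precomp (Prod.mk_right_injective k)).comp
    (fun _ x => (x : ℝ) - mean θ k) fun _ => measurable_subtype_coe.sub_const _

theorem hasSubgaussianMGF_reward_sub {K : ℕ} (θ : Env K) (k : Fin K) (s : ℕ) :
    HasSubgaussianMGF (fun ω : Sample K => (ω.1 (k, s) : ℝ) - mean θ k) (1 / 4) (law θ) := by
  have h := hasSubgaussianMGF_of_mem_Icc (μ := law θ) (a := 0) (b := 1)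
    (measurable_reward (k, s)).aemeasurable (Eventually.of_forall fun ω => (ω.1 (k, s)).2)
  rw [integral_reward] at h
  convert h using 1
  norm_num

theorem integral_reward_sub {K : ℕ} (θ : Env K) (k : Fin K) (s : ℕ) :
    ∫ ω : Sample K, ((ω.1 (k, s) : ℝ) - mean θ k) ∂law θ = 0 := by
  rw [integral_sub (integrable_reward θ _) (integrable_const _), integral_reward]
  simp

/-- The samples of arm `k` deviate above its mean, at some time before `t`. -/
def devAbove {K : ℕ} (θ : Env K) (ρ : ℝ) (k : Fin K) (t : ℕ) : Set (Sample K) :=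
  {ω | ∃ s, 1 ≤ s ∧ s ≤ t ∧ Real.sqrt (ρ * s * Real.log t) ≤
    ∑ i ∈ Finset.range s, ((ω.1 (k, i) : ℝ) - mean θ k)}

/-- The samples of arm `k` deviate below its mean, at some time before `t`. -/
def devBelow {K : ℕ} (θ : Env K) (ρ : ℝ) (k : Fin K) (t : ℕ) : Set (Sample K) :=
  {ω | ∃ s, 1 ≤ s ∧ s ≤ t ∧ Real.sqrt (ρ * s * Real.log t) ≤
    ∑ i ∈ Finset.range s, -((ω.1 (k, i) : ℝ) - mean θ k)}

theorem measureReal_devAbove_le {K : ℕ} (θ : Env K) {ρ β : ℝ} (hρ : 0 < ρ) (hβ0 : 0 < β)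
    (hβ1 : β < 1) (k : Fin K) {t : ℕ} (ht : 2 ≤ t) :
    (law θ).real (devAbove θ ρ k t) ≤
      (Real.log t / Real.log (1 / β) + 1) * (t : ℝ) ^ (-(2 * ρ * β)) :=
  measureReal_exists_sqrt_le_sum_le (iIndepFun_reward_sub θ k)
    (fun s => (measurable_reward (k, s)).sub_const _) (hasSubgaussianMGF_reward_sub θ k)
    (integral_reward_sub θ k) hρ hβ0 hβ1 ht

theorem measureReal_devBelow_le {K : ℕ} (θ : Env K) {ρ β : ℝ} (hρ : 0 < ρ) (hβ0 : 0 < β)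
    (hβ1 : β < 1) (k : Fin K) {t : ℕ} (ht : 2 ≤ t) :
    (law θ).real (devBelow θ ρ k t) ≤
      (Real.log t / Real.log (1 / β) + 1) * (t : ℝ) ^ (-(2 * ρ * β)) :=
  measureReal_exists_sqrt_le_sum_le
    ((iIndepFun_reward_sub θ k).comp (fun _ x => -x) fun _ => measurable_neg)
    (fun s => ((measurable_reward (k, s)).sub_const _).neg)
    (fun s => (hasSubgaussianMGF_reward_sub θ k s).neg)
    (fun s => by
      simp only [Function.comp_def]
      rw [integral_neg, integral_reward_sub, neg_zero]) hρ hβ0 hβ1 ht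

theorem sqrt_mul_eq_mul_sqrt_div {s : ℝ} (hs : 0 < s) (x : ℝ) :
    Real.sqrt (x * s) = s * Real.sqrt (x / s) := by
  have : x * s = s ^ 2 * (x / s) := by field_simp
  rw [this, Real.sqrt_mul (by positivity), Real.sqrt_sq hs.le]

variable {K : ℕ} [NeZero K]

/-- A suboptimal arm that was already pulled often is drawn again only if a deviation occurs. -/
theorem mem_dev_of_arm_eq {ρ : ℝ} (hρ : 0 < ρ) {σ : Policy K} (hσ : IsUCB ρ σ) {θ : Env K}
    {ω : Sample K} {t n : ℕ} (hsupp : arm σ ω t ∈ (σ.choice t (run σ ω t)).support) (htn : t < n)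
    {k : Fin K} (hgap : 0 < gap θ k) (harm : arm σ ω t = k) (h1 : 1 ≤ pulls (run σ ω t) k)
    (hpulls : 4 * ρ * Real.log n / gap θ k ^ 2 ≤ pulls (run σ ω t) k) :
    ω ∈ devBelow θ ρ (bestArm θ) (t + 1) ∪ devAbove θ ρ k (t + 1) := by
  rw [harm] at hsupp
  obtain ⟨hzero, hmax⟩ := hσ t _ k hsupp
  -- While some arm is undrawn, only undrawn arms are allowed; `k` is drawn again, so the initial
  -- phase is over.
  have hall : ∀ j, pulls (run σ ω t) j ≠ 0 := fun j hj => by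
    have := hzero ⟨j, hj⟩
    omega
  have hidx := hmax hall (bestArm θ)
  by_contra hnot
  rw [Set.mem_union, not_or] at hnot
  obtain ⟨hb, ha⟩ := hnot
  simp only [devBelow, devAbove, Set.mem_ofPred_eq, not_exists, not_and, not_le] at ha hb
  have hb' := hb _ (Nat.one_le_iff_ne_zero.2 (hall (bestArm θ))) ((pulls_le _ _).trans t.le_succ)
  have ha' := ha _ h1 ((pulls_le _ _).trans t.le_succ)
  have hs : (0 : ℝ) < pulls (run σ ω t) k := by exact_mod_cast h1
  have hs' : (0 : ℝ) < pulls (run σ ω t) (bestArm θ) := by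
    exact_mod_cast Nat.pos_of_ne_zero (hall (bestArm θ))
  unfold ucbIndex at hidx
  rw [empMean_run, empMean_run] at hidx
  set L := Real.log ((t : ℝ) + 1) with hL
  have hcast : ((t + 1 : ℕ) : ℝ) = (t : ℝ) + 1 := by push_cast; rfl
  rw [hcast, mul_right_comm, sqrt_mul_eq_mul_sqrt_div hs, Finset.sum_sub_distrib] at ha'
  rw [hcast, mul_right_comm, sqrt_mul_eq_mul_sqrt_div hs', Finset.sum_neg_distrib,
    Finset.sum_sub_distrib] at hb'
  simp only [Finset.sum_const, Finset.card_range, nsmul_eq_mul] at ha' hb'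
  have hak : (∑ s ∈ Finset.range (pulls (run σ ω t) k), (ω.1 (k, s) : ℝ)) /
      pulls (run σ ω t) k < mean θ k + Real.sqrt (ρ * L / pulls (run σ ω t) k) := by
    rw [div_lt_iff₀ hs]
    linarith
  have hbk : mean θ (bestArm θ) - Real.sqrt (ρ * L / pulls (run σ ω t) (bestArm θ)) <
      (∑ s ∈ Finset.range (pulls (run σ ω t) (bestArm θ)), (ω.1 (bestArm θ, s) : ℝ)) /
        pulls (run σ ω t) (bestArm θ) := by
    rw [lt_div_iff₀ hs']
    linarith
  -- The index of `k` is below its mean plus twice its bonus, hence below the best mean, while the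
  -- index of the best arm is above it.
  have hsq : Real.sqrt (ρ * L / pulls (run σ ω t) k) ≤ gap θ k / 2 := by
    refine Real.sqrt_le_iff.2 ⟨by positivity, ?_⟩
    have hLn : L ≤ Real.log n := Real.log_le_log (by positivity) (by exact_mod_cast htn)
    rw [div_le_iff₀ (by positivity)] at hpulls
    rw [div_le_iff₀ hs]
    nlinarith [mul_le_mul_of_nonneg_left hLn hρ.le]
  have hg : gap θ k = mean θ (bestArm θ) - mean θ k := rfl
  linarith

/-- Every pull after the first `u` is made when the count is already at least `u`. -/
theorem pulls_le_add_sum (σ : Policy K) (ω : Sample K) (k : Fin K) (u n : ℕ) :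
    pulls (run σ ω n) k ≤
      u + ∑ t ∈ Finset.range n, if arm σ ω t = k ∧ u ≤ pulls (run σ ω t) k then 1 else 0 := by
  induction n with
  | zero => simp [pulls_run_zero]
  | succ n ih =>
    rw [pulls_run_succ, Finset.sum_range_succ]
    split_ifs with h1 h2 h2
    · omega
    · have : pulls (run σ ω n) k < u := not_le.1 fun h => h2 ⟨h1, h⟩
      omega
    · exact absurd h2.1 h1
    · omega

/-- A discrete comparison with `∫ x^(-a)`: Bernoulli's inequality for the exponent `1 - a` bounds
each term by an increment of `x^(1-a) / (1-a)`. -/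
theorem sum_rpow_neg_le {a : ℝ} (ha0 : 0 ≤ a) (ha1 : a < 1) (n : ℕ) :
    ∑ t ∈ Finset.Ico 1 (n + 1), ((t : ℝ) + 1) ^ (-a) ≤
      (((n : ℝ) + 1) ^ (1 - a) - 1) / (1 - a) := by
  induction n with
  | zero => simp
  | succ n ih =>
    rw [Finset.sum_Ico_succ_top (by omega)]
    refine (add_le_add_left ih _).trans ?_
    have hpos : (0 : ℝ) < (n : ℝ) + 1 + 1 := by positivity
    have hb := rpow_one_add_le_one_add_mul_self (s := -(1 / ((n : ℝ) + 1 + 1)))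
      (p := 1 - a) (by
        rw [neg_le_neg_iff, div_le_one hpos]
        linarith [(Nat.cast_nonneg n : (0 : ℝ) ≤ n)]) (by linarith) (by linarith)
    have h1 : 1 + -(1 / ((n : ℝ) + 1 + 1)) = ((n : ℝ) + 1) / ((n : ℝ) + 1 + 1) := by
      field_simp
      ring
    rw [h1, Real.div_rpow (by positivity) hpos.le, div_le_iff₀ (by positivity)] at hb
    have h2 : ((n : ℝ) + 1 + 1) ^ (1 - a) = ((n : ℝ) + 1 + 1) ^ (-a) * ((n : ℝ) + 1 + 1) := by
      rw [← Real.rpow_add_one hpos.ne']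
      congr 1
      ring
    push_cast
    rw [← sub_nonneg]
    have hkey : ((n : ℝ) + 1) ^ (1 - a) + (1 - a) * ((n : ℝ) + 1 + 1) ^ (-a) ≤
        ((n : ℝ) + 1 + 1) ^ (1 - a) := by
      refine (add_le_add_left hb _).trans_eq ?_
      rw [h2]
      field_simp
      ring
    have h1a : 0 < 1 - a := by linarith
    have : (((n : ℝ) + 1 + 1) ^ (1 - a) - 1) / (1 - a) -
        ((((n : ℝ) + 1) ^ (1 - a) - 1) / (1 - a) + ((n : ℝ) + 1 + 1) ^ (-a)) =
        (((n : ℝ) + 1 + 1) ^ (1 - a) -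
          (((n : ℝ) + 1) ^ (1 - a) + (1 - a) * ((n : ℝ) + 1 + 1) ^ (-a))) / (1 - a) := by
      field_simp
      ring
    rw [this]
    exact div_nonneg (by linarith) h1a.le

theorem integral_pulls_le {ρ β : ℝ} (hρ0 : 0 < ρ) (hρ1 : ρ < 1 / 2) {σ : Policy K}
    (hσ : IsUCB ρ σ) (θ : Env K) (hβ0 : 0 < β) (hβ1 : β < 1) {k : Fin K}
    (hgap : 0 < gap θ k) {n : ℕ} (hn : 1 ≤ n) :
    ∫ ω, (pulls (run σ ω n) k : ℝ) ∂law θ ≤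
      4 * ρ * Real.log n / gap θ k ^ 2 + 1 + 2 * (Real.log n / Real.log (1 / β) + 1) *
        (((n : ℝ) ^ (1 - 2 * ρ * β) - 1) / (1 - 2 * ρ * β)) := by
  have hlb : 0 < Real.log (1 / β) := Real.log_pos (by rw [one_div]; exact (one_lt_inv₀ hβ0).2 hβ1)
  have hlogn : 0 ≤ Real.log n := Real.log_natCast_nonneg n
  have ha1 : 2 * ρ * β < 1 := by nlinarith
  set x := 4 * ρ * Real.log n / gap θ k ^ 2 with hx
  have hx0 : 0 ≤ x := by positivity
  set u := ⌊x⌋₊ + 1 with hu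
  set A : ℕ → Set (Sample K) := fun t => {ω | arm σ ω t = k ∧ u ≤ pulls (run σ ω t) k} with hA
  have hAm : ∀ t, MeasurableSet (A t) := fun t =>
    (measurable_arm σ t (measurableSet_singleton k)).inter
      (measurable_pulls_run σ t k measurableSet_Ici)
  -- As `u ≥ 1`, the first round does not count, and the deviation bounds are needed only at times
  -- `t + 1 ≥ 2`.
  have hA0 : A 0 = ∅ := by
    ext ω
    simp [hA, hu, pulls_run_zero]
  have hAt : ∀ t ∈ Finset.Ico 1 n, (law θ).real (A t) ≤
      2 * (Real.log n / Real.log (1 / β) + 1) * ((t : ℝ) + 1) ^ (-(2 * ρ * β)) := by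
    intro t ht
    rw [Finset.mem_Ico] at ht
    have hsub : A t ≤ᵐ[law θ] (devBelow θ ρ (bestArm θ) (t + 1) ∪ devAbove θ ρ k (t + 1) : Set _) := by
      filter_upwards [ae_arm_mem_support σ θ] with ω hω hmem
      obtain ⟨h1, h2⟩ := hmem
      refine mem_dev_of_arm_eq hρ0 hσ (hω t) ht.2 hgap h1 (le_trans (by omega) h2) ?_
      refine (Nat.lt_floor_add_one x).le.trans ?_
      exact_mod_cast h2
    have hle : (law θ).real (A t) ≤
        (law θ).real (devBelow θ ρ (bestArm θ) (t + 1) ∪ devAbove θ ρ k (t + 1)) :=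
      ENNReal.toReal_mono (measure_ne_top _ _) (measure_mono_ae hsub)
    have hlogt : Real.log ((t + 1 : ℕ) : ℝ) ≤ Real.log n :=
      Real.log_le_log (by positivity) (by exact_mod_cast ht.2)
    have h1 := measureReal_devBelow_le θ hρ0 hβ0 hβ1 (bestArm θ) (t := t + 1) (by omega)
    have h2 := measureReal_devAbove_le θ hρ0 hβ0 hβ1 k (t := t + 1) (by omega)
    have h3 : (Real.log ((t + 1 : ℕ) : ℝ) / Real.log (1 / β) + 1) *
        ((t + 1 : ℕ) : ℝ) ^ (-(2 * ρ * β)) ≤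
        (Real.log n / Real.log (1 / β) + 1) * ((t + 1 : ℕ) : ℝ) ^ (-(2 * ρ * β)) := by
      gcongr
    have h4 := measureReal_union_le (μ := law θ) (devBelow θ ρ (bestArm θ) (t + 1))
      (devAbove θ ρ k (t + 1))
    push_cast at h1 h2 h3
    linarith
  have hint : ∀ t, Integrable ((A t).indicator fun _ => (1 : ℝ)) (law θ) := fun t =>
    (integrable_const _).indicator (hAm t)
  have hle : ∫ ω, (pulls (run σ ω n) k : ℝ) ∂law θ ≤
      ∫ ω, ((u : ℝ) + ∑ t ∈ Finset.range n, (A t).indicator (fun _ => (1 : ℝ)) ω) ∂law θ := by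
    refine integral_mono (integrable_pulls σ θ n k)
      ((integrable_const _).add (integrable_finsetSum _ fun t _ => hint t)) fun ω => ?_
    have := pulls_le_add_sum σ ω k u n
    simp only [Set.indicator_apply, hA, Set.mem_ofPred_eq]
    exact_mod_cast this
  rw [integral_add (integrable_const _) (integrable_finsetSum _ fun t _ => hint t),
    integral_finsetSum _ fun t _ => hint t] at hle
  simp only [integral_indicator_const _ (hAm _), integral_const, probReal_univ, smul_eq_mul,
    mul_one, one_mul] at hle
  rw [Finset.range_eq_Ico, Finset.sum_eq_sum_Ico_succ_bot (by omega), hA0, measureReal_empty,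
    zero_add] at hle
  have hsum : ∑ t ∈ Finset.Ico (0 + 1) n, (law θ).real (A t) ≤
      2 * (Real.log n / Real.log (1 / β) + 1) *
        (((n : ℝ) ^ (1 - 2 * ρ * β) - 1) / (1 - 2 * ρ * β)) := by
    refine (Finset.sum_le_sum hAt).trans ?_
    rw [← Finset.mul_sum]
    refine mul_le_mul_of_nonneg_left ?_ (by positivity)
    obtain ⟨m, rfl⟩ : ∃ m, n = m + 1 := ⟨n - 1, by omega⟩
    have := sum_rpow_neg_le (a := 2 * ρ * β) (by positivity) ha1 m
    push_cast
    exact this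
  have hux : (u : ℝ) ≤ x + 1 := by
    rw [hu]
    push_cast
    linarith [Nat.floor_le hx0]
  linarith

theorem expRegret_le {ρ β : ℝ} (hρ0 : 0 < ρ) (hρ1 : ρ < 1 / 2) {σ : Policy K}
    (hσ : IsUCB ρ σ) (θ : Env K) (hβ0 : 0 < β) (hβ1 : β < 1) {n : ℕ} (hn : 1 ≤ n) :
    expRegret σ θ n ≤ ∑ k with 0 < gap θ k,
      (4 * Real.log n / gap θ k + 2 * gap θ k * (Real.log n / Real.log (1 / β) + 1) *
        ((n : ℝ) ^ (1 - 2 * ρ * β) / (1 - 2 * ρ * β))) := by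
  rw [expRegret_eq, Finset.sum_filter]
  refine Finset.sum_le_sum fun k _ => ?_
  split_ifs with hgap
  swap
  · rw [le_antisymm (not_lt.1 hgap) (gap_nonneg θ k), zero_mul]
  have hlb : 0 < Real.log (1 / β) := Real.log_pos (by rw [one_div]; exact (one_lt_inv₀ hβ0).2 hβ1)
  have hlogn : 0 ≤ Real.log n := Real.log_natCast_nonneg n
  have ha1 : 0 < 1 - 2 * ρ * β := by nlinarith
  refine (mul_le_mul_of_nonneg_left (integral_pulls_le hρ0 hρ1 hσ θ hβ0 hβ1 hgap hn)
    hgap.le).trans ?_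
  set D := gap θ k
  set M := Real.log n / Real.log (1 / β) + 1 with hM
  have hM1 : 1 ≤ M := by
    have : 0 ≤ Real.log n / Real.log (1 / β) := by positivity
    linarith
  set c := 1 - 2 * ρ * β with hc
  have hc1 : c ≤ 1 := by
    have : 0 < 2 * ρ * β := by positivity
    linarith
  have h1 : D * (4 * ρ * Real.log n / D ^ 2) ≤ 4 * Real.log n / D := by
    have : D * (4 * ρ * Real.log n / D ^ 2) = 4 * (ρ * Real.log n) / D := by field_simp
    rw [this]
    gcongr
    nlinarith
  -- The `-1` kept in `integral_pulls_le` contributes `-2DM/c`, which absorbs the extra pull `+1`.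
  have h2 : 1 ≤ M * (1 / c) := by
    refine one_le_mul_of_one_le_of_one_le hM1 ?_
    rw [le_div_iff₀ ha1]
    linarith
  have h3 : D * (2 * M * (((n : ℝ) ^ c - 1) / c)) =
      2 * D * M * ((n : ℝ) ^ c / c) - 2 * D * (M * (1 / c)) := by
    field_simp
  rw [mul_add, mul_add, h3]
  nlinarith

theorem isConsistent_of_isUCB {ρ : ℝ} (hρ0 : 0 < ρ) (hρ1 : ρ < 1 / 2) {σ : Policy K}
    (hσ : IsUCB ρ σ) (Θ : Set (Env K)) : IsConsistent (1 - 2 * ρ) Θ σ := by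
  intro a ha θ _
  have ha0 : 0 < a := by linarith
  -- Some room is left between `1 - 2ρβ` and `a`, to beat the logarithm.
  obtain ⟨β, hβ0, hβ1, hβa⟩ : ∃ β : ℝ, 0 < β ∧ β < 1 ∧ 1 - 2 * ρ * β < a := by
    have hb : max ((1 - a) / (2 * ρ)) 0 < 1 := by
      refine max_lt ?_ one_pos
      rw [div_lt_one (by positivity)]
      linarith
    obtain ⟨β, h1, h2⟩ := exists_between hb
    refine ⟨β, (le_max_right _ _).trans_lt h1, h2, ?_⟩
    have := (le_max_left _ _).trans_lt h1
    rw [div_lt_iff₀ (by positivity)] at this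
    linarith
  set c := 1 - 2 * ρ * β with hc
  have hlog : ∀ r : ℝ, 0 < r → (fun n : ℕ => Real.log n) =o[atTop] fun n : ℕ => (n : ℝ) ^ r :=
    fun r hr => (isLittleO_log_rpow_atTop hr).comp_tendsto tendsto_natCast_atTop_atTop
  have hmul : (fun n : ℕ => Real.log n * (n : ℝ) ^ c) =o[atTop] fun n : ℕ => (n : ℝ) ^ a := by
    refine ((hlog (a - c) (by linarith)).mul_isBigO
      (isBigO_refl (fun n : ℕ => (n : ℝ) ^ c) atTop)).congr' EventuallyEq.rfl ?_
    filter_upwards [eventually_gt_atTop 0] with n hn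
    rw [← Real.rpow_add (by exact_mod_cast hn)]
    congr 1
    ring
  have hpow : (fun n : ℕ => (n : ℝ) ^ c) =o[atTop] fun n : ℕ => (n : ℝ) ^ a := by
    refine IsBigO.trans_isLittleO (IsBigO.of_bound 1 ?_) hmul
    filter_upwards [(Real.tendsto_log_atTop.comp tendsto_natCast_atTop_atTop).eventually_ge_atTop 1]
      with n hn
    rw [one_mul, norm_mul]
    exact le_mul_of_one_le_left (norm_nonneg _) (hn.trans (le_abs_self _))
  have hbound : (fun n : ℕ => ∑ k with 0 < gap θ k,
      (4 * Real.log n / gap θ k + 2 * gap θ k * (Real.log n / Real.log (1 / β) + 1) *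
        ((n : ℝ) ^ c / c))) =o[atTop] fun n : ℕ => (n : ℝ) ^ a := by
    refine IsLittleO.fun_sum fun k _ => ?_
    have := ((hlog a ha0).const_mul_left (4 / gap θ k)).add
      ((hmul.const_mul_left (2 * gap θ k / Real.log (1 / β) / c)).add
        (hpow.const_mul_left (2 * gap θ k / c)))
    refine this.congr_left fun n => ?_
    ring
  refine IsBigO.trans_isLittleO (IsBigO.of_bound 1 ?_) hbound
  filter_upwards [eventually_ge_atTop 1] with n hn
  have h := expRegret_le hρ0 hρ1 hσ θ hβ0 hβ1 hn
  rw [one_mul, Real.norm_of_nonneg (expRegret_nonneg σ θ n)]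
  exact h.trans (le_abs_self _)

end Bandit

/-! ### Lower bound for central binomial probabilities -/

section Binomial

/-- In other words, the Poisson weights `m^j / j!` are largest at `j = m`. -/
theorem factorial_mul_pow_le_factorial_mul_pow (m j : ℕ) :
    m.factorial * m ^ j ≤ j.factorial * m ^ m := by
  rcases le_total m j with h | h
  · calc m.factorial * m ^ j = m.factorial * m ^ (j - m) * m ^ m := by
          rw [mul_assoc, ← pow_add, Nat.sub_add_cancel h]
      _ ≤ _ := Nat.mul_le_mul_right _ (Nat.factorial_mul_pow_sub_le_factorial h)
  · calc m.factorial * m ^ j ≤ j.factorial * m ^ (m - j) * m ^ j :=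
          Nat.mul_le_mul_right _ (by
            rw [← Nat.factorial_mul_descFactorial (Nat.sub_le m j), Nat.sub_sub_self h]
            exact Nat.mul_le_mul_left _ (Nat.descFactorial_le_pow _ _))
      _ = _ := by rw [mul_assoc, ← pow_add, Nat.sub_add_cancel h]

/-- The mode of a binomial distribution carries at least the average mass. -/
theorem pow_self_le_succ_mul_choose {m s : ℕ} (h : m ≤ s) :
    s ^ s ≤ (s + 1) * (s.choose m * (m ^ m * (s - m) ^ (s - m))) := by
  have hterm : ∀ j ∈ Finset.range (s + 1), m ^ j * (s - m) ^ (s - j) * s.choose j ≤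
      s.choose m * (m ^ m * (s - m) ^ (s - m)) := by
    intro j hj
    have hj' : j ≤ s := Nat.lt_succ_iff.1 (Finset.mem_range.1 hj)
    have h1 := factorial_mul_pow_le_factorial_mul_pow m j
    have h2 := factorial_mul_pow_le_factorial_mul_pow (s - m) (s - j)
    have h3 := Nat.choose_mul_factorial_mul_factorial h
    have h4 := Nat.choose_mul_factorial_mul_factorial hj'
    have h5 := Nat.mul_le_mul h1 h2
    have hpos : 0 < m.factorial * (s - m).factorial * (j.factorial * (s - j).factorial) := by
      positivity
    refine Nat.le_of_mul_le_mul_right ?_ hpos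
    calc m ^ j * (s - m) ^ (s - j) * s.choose j *
          (m.factorial * (s - m).factorial * (j.factorial * (s - j).factorial))
        = (m.factorial * m ^ j * ((s - m).factorial * (s - m) ^ (s - j))) *
          (s.choose j * j.factorial * (s - j).factorial) := by ring
      _ ≤ (j.factorial * m ^ m * ((s - j).factorial * (s - m) ^ (s - m))) *
          (s.choose j * j.factorial * (s - j).factorial) := Nat.mul_le_mul_right _ h5
      _ = (j.factorial * m ^ m * ((s - j).factorial * (s - m) ^ (s - m))) *
          (s.choose m * m.factorial * (s - m).factorial) := by rw [h4, h3]
      _ = _ := by ring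
  calc s ^ s = (m + (s - m)) ^ s := by rw [Nat.add_sub_cancel' h]
    _ = ∑ j ∈ Finset.range (s + 1), m ^ j * (s - m) ^ (s - j) * s.choose j := add_pow _ _ _
    _ ≤ ∑ _j ∈ Finset.range (s + 1), s.choose m * (m ^ m * (s - m) ^ (s - m)) :=
        Finset.sum_le_sum hterm
    _ = _ := by simp

/-- Twice the relative entropy of a coin of bias `(1 - z)/2` with respect to a fair one.
Second-order expansions of both logarithms with remainder `2z³` give the bound; its leading
coefficient `1` is what makes the exponent `2ρ` sharp. -/
theorem mul_log_add_mul_log_le {z : ℝ} (hz0 : 0 ≤ z) (hz1 : z ≤ 1 / 2) :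
    (1 - z) * Real.log (1 - z) + (1 + z) * Real.log (1 + z) ≤ z ^ 2 + 4 * z ^ 3 := by
  have hd : z ^ 3 / (1 - z) ≤ 2 * z ^ 3 := by
    rw [div_le_iff₀ (by linarith)]
    nlinarith [pow_nonneg hz0 3]
  have h1 := Real.abs_log_sub_add_sum_range_le (x := z) (by rw [abs_of_nonneg hz0]; linarith) 2
  have h2 := Real.abs_log_sub_add_sum_range_le (x := -z)
    (by rw [abs_neg, abs_of_nonneg hz0]; linarith) 2
  rw [abs_neg] at h2
  rw [abs_of_nonneg hz0] at h1 h2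
  have h1' := (le_abs_self _).trans (h1.trans hd)
  have h2' := (le_abs_self _).trans (h2.trans hd)
  simp only [Finset.sum_range_succ, Finset.sum_range_zero, sub_neg_eq_add] at h1' h2'
  norm_num at h1' h2'
  have h3 := mul_le_mul_of_nonneg_left h1' (by linarith : 0 ≤ 1 - z)
  have h4 := mul_le_mul_of_nonneg_left h2' (by linarith : 0 ≤ 1 + z)
  nlinarith

/-- A lower bound for the symmetric binomial probabilities, sharp on the exponential scale near
the center. -/
theorem exp_neg_div_le_choose_div_two_pow {s m : ℕ} (hs : 0 < s) (hm : m ≤ s) {z : ℝ}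
    (hz0 : 0 ≤ z) (hz1 : z ≤ 1 / 2) (hmz : 2 * (m : ℝ) = s * (1 - z)) :
    Real.exp (-(s * ((z ^ 2 + 4 * z ^ 3) / 2))) / (s + 1) ≤ (s.choose m : ℝ) / 2 ^ s := by
  have hs' : (0 : ℝ) < s := by exact_mod_cast hs
  have hnat : (s : ℝ) ^ s ≤
      (s + 1) * (s.choose m * ((m : ℝ) ^ m * ((s : ℝ) - m) ^ (s - m))) := by
    have h := pow_self_le_succ_mul_choose hm
    rw [← Nat.cast_sub hm]
    exact_mod_cast h
  have hsm : 2 * ((s : ℝ) - m) = s * (1 + z) := by linarith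
  have hsplit : ∀ x : ℝ, x ^ s = x ^ m * x ^ (s - m) := fun x => by
    rw [← pow_add, Nat.add_sub_cancel' hm]
  -- The mode inequality divided by `(s/2)^s`, with `m = s(1-z)/2` and `s - m = s(1+z)/2`.
  have hle : (2 : ℝ) ^ s ≤ (s + 1) * s.choose m * ((1 - z) ^ m * (1 + z) ^ (s - m)) := by
    refine le_of_mul_le_mul_left ?_ (pow_pos hs' s)
    calc (s : ℝ) ^ s * 2 ^ s
        ≤ (s + 1) * (s.choose m * ((m : ℝ) ^ m * ((s : ℝ) - m) ^ (s - m))) * 2 ^ s := by gcongr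
      _ = (s + 1) * s.choose m * ((2 * (m : ℝ)) ^ m * (2 * ((s : ℝ) - m)) ^ (s - m)) := by
          rw [hsplit 2, mul_pow, mul_pow]
          ring
      _ = _ := by
          rw [hmz, hsm, mul_pow, mul_pow, hsplit (s : ℝ)]
          ring
  have hexp : (1 - z) ^ m * (1 + z) ^ (s - m) ≤
      Real.exp (s * ((z ^ 2 + 4 * z ^ 3) / 2)) := by
    have e1 : (1 - z) ^ m = Real.exp (m * Real.log (1 - z)) := by
      rw [mul_comm, Real.exp_mul, Real.exp_log (by linarith), Real.rpow_natCast]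
    have e2 : (1 + z) ^ (s - m) = Real.exp (((s : ℝ) - m) * Real.log (1 + z)) := by
      rw [mul_comm, Real.exp_mul, Real.exp_log (by linarith), ← Nat.cast_sub hm,
        Real.rpow_natCast]
    rw [e1, e2, ← Real.exp_add, Real.exp_le_exp]
    have em : (m : ℝ) = s * (1 - z) / 2 := by linarith
    have esm : (s : ℝ) - m = s * (1 + z) / 2 := by linarith
    rw [esm, em]
    have := mul_le_mul_of_nonneg_left (mul_log_add_mul_log_le hz0 hz1) hs'.le
    linarith
  rw [Real.exp_neg, div_le_div_iff₀ (by positivity) (by positivity), inv_mul_le_iff₀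
    (Real.exp_pos _)]
  calc (2 : ℝ) ^ s ≤ (s + 1) * s.choose m * ((1 - z) ^ m * (1 + z) ^ (s - m)) := hle
    _ ≤ (s + 1) * s.choose m * Real.exp (s * ((z ^ 2 + 4 * z ^ 3) / 2)) := by gcongr
    _ = _ := by ring

end Binomial

/-! ### A fair coin against constant arms -/

namespace Bandit

theorem integral_twoPoint (p a b : unitInterval) :
    ∫ x : unitInterval, (x : ℝ) ∂(twoPoint p a b : Measure unitInterval) =
      p * a + (1 - p) * b := by
  have hi : ∀ (r : ENNReal) (c : unitInterval), r ≠ ⊤ →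
      Integrable (fun x : unitInterval => (x : ℝ)) (r • Measure.dirac c) := fun r c hr =>
    (integrable_dirac (by simp)).smul_measure hr
  simp only [twoPoint, ProbabilityMeasure.coe_mk]
  rw [integral_add_measure (hi _ _ ENNReal.ofReal_ne_top) (hi _ _ ENNReal.ofReal_ne_top),
    integral_smul_measure, integral_smul_measure, integral_dirac, integral_dirac,
    ENNReal.toReal_ofReal p.2.1, ENNReal.toReal_ofReal (sub_nonneg.2 p.2.2)]
  simp

theorem twoPoint_one (a b : unitInterval) :
    (twoPoint 1 a b : Measure unitInterval) = Measure.dirac a := by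
  simp [twoPoint, ProbabilityMeasure.coe_mk]

/-- The midpoint of the unit interval. -/
noncomputable def half : unitInterval := ⟨1 / 2, by norm_num, by norm_num⟩

theorem twoPoint_half_apply_singleton {v : unitInterval} (hv : v = 0 ∨ v = 1) :
    (twoPoint half 1 0 : Measure unitInterval) {v} = 2⁻¹ := by
  have h1 : ENNReal.ofReal (1 / 2) = 2⁻¹ := by
    rw [one_div, ENNReal.ofReal_inv_of_pos two_pos]
    simp
  have h2 : ENNReal.ofReal (1 - 1 / 2) = 2⁻¹ := by
    rw [← h1]
    norm_num
  rcases hv with rfl | rfl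
  · simp only [twoPoint, ProbabilityMeasure.coe_mk, half, h1, h2]
    simp
  · simp only [twoPoint, ProbabilityMeasure.coe_mk, half, h1, h2]
    simp

variable {K : ℕ} [NeZero K]

/-- The environment whose arm `0` is a fair coin and whose other arms are constant. -/
noncomputable def coinEnv (K : ℕ) [NeZero K] (c : unitInterval) : Env K := fun k =>
  if k = 0 then twoPoint half 1 0 else twoPoint 1 c c

theorem mean_coinEnv_zero (c : unitInterval) : mean (coinEnv K c) 0 = 1 / 2 := by
  rw [mean, coinEnv, if_pos rfl, integral_twoPoint]
  simp [half]

theorem mean_coinEnv_of_ne (c : unitInterval) {k : Fin K} (hk : k ≠ 0) :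
    mean (coinEnv K c) k = c := by
  rw [mean, coinEnv, if_neg hk, integral_twoPoint]
  simp

theorem mean_bestArm_coinEnv {c : unitInterval} (hc : (c : ℝ) ≤ 1 / 2) :
    mean (coinEnv K c) (bestArm (coinEnv K c)) = 1 / 2 := by
  refine le_antisymm ?_ ?_
  · by_cases h : bestArm (coinEnv K c) = 0
    · rw [h, mean_coinEnv_zero]
    · rwa [mean_coinEnv_of_ne c h]
  · rw [← mean_coinEnv_zero (K := K) c]
    exact (Finite.exists_max (mean (coinEnv K c))).choose_spec 0

/-- All arms but the coin have the same gap, so only the number of rounds spent away from the coin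
matters. -/
theorem expRegret_coinEnv {c : unitInterval} (hc : (c : ℝ) ≤ 1 / 2) (σ : Policy K) (n : ℕ) :
    expRegret σ (coinEnv K c) n =
      (1 / 2 - c) * ∫ ω, ((n : ℝ) - pulls (run σ ω n) 0) ∂law (coinEnv K c) := by
  have hsum : ∀ ω : Sample K, (n : ℝ) - pulls (run σ ω n) 0 =
      ∑ k ∈ Finset.univ.erase 0, (pulls (run σ ω n) k : ℝ) := by
    intro ω
    have h := sum_pulls (run σ ω n)
    rw [← Finset.add_sum_erase _ _ (Finset.mem_univ 0)] at h
    have h' : ((pulls (run σ ω n) 0 : ℕ) : ℝ) +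
        ∑ k ∈ Finset.univ.erase 0, (pulls (run σ ω n) k : ℝ) = n := by exact_mod_cast h
    linarith
  simp only [hsum]
  rw [integral_finsetSum _ fun k _ => integrable_pulls σ _ n k, expRegret_eq,
    ← Finset.add_sum_erase _ _ (Finset.mem_univ 0), Finset.mul_sum, gap, mean_bestArm_coinEnv hc,
    mean_coinEnv_zero, sub_self, zero_mul, zero_add]
  refine Finset.sum_congr rfl fun k hk => ?_
  rw [gap, mean_bestArm_coinEnv hc, mean_coinEnv_of_ne c (Finset.ne_of_mem_erase hk)]

theorem ae_reward_coinEnv (c : unitInterval) :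
    ∀ᵐ ω ∂law (coinEnv K c), ∀ k ≠ 0, ∀ s, ω.1 (k, s) = c := by
  simp only [ae_all_iff]
  intro k hk s
  refine (measurePreserving_reward (coinEnv K c) (k, s)).quasiMeasurePreserving.ae
    (p := fun x => x = c) ?_
  simp only [coinEnv, if_neg hk, twoPoint_one]
  rw [ae_dirac_eq]
  rfl

/-- If the first `s` draws of the coin are bad enough, it is abandoned until round `n`. -/
theorem pulls_zero_le {ρ : ℝ} (hρ : 0 < ρ) (hK : 2 ≤ K) {σ : Policy K} (hσ : IsUCB ρ σ)
    {c : unitInterval} {ω : Sample K}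
    (hsupp : ∀ t, arm σ ω t ∈ (σ.choice t (run σ ω t)).support)
    (hc : ∀ k ≠ 0, ∀ s, ω.1 (k, s) = c) {s n : ℕ} (hs : 0 < s)
    (hbad : (∑ i ∈ Finset.range s, (ω.1 (0, i) : ℝ)) / s + Real.sqrt (ρ * Real.log n / s) < c)
    {t : ℕ} (ht : t ≤ n) : pulls (run σ ω t) 0 ≤ s := by
  induction t with
  | zero => simp [pulls_run_zero]
  | succ t ih =>
    have ih' := ih (by omega)
    rw [pulls_run_succ]
    split_ifs with harm
    swap
    · exact ih'
    -- Only the toss number `s + 1` must be excluded; at that moment the coin's empirical mean is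
    -- that of its first `s` tosses.
    refine Nat.succ_le_of_lt (lt_of_le_of_ne ih' fun heq => ?_)
    have hmem := hsupp t
    rw [harm] at hmem
    obtain ⟨hzero, hmax⟩ := hσ t _ 0 hmem
    have hall : ∀ j, pulls (run σ ω t) j ≠ 0 := fun j hj => by
      have := hzero ⟨j, hj⟩
      omega
    have hone : (⟨1, hK⟩ : Fin K) ≠ 0 := by
      rw [Ne, Fin.ext_iff]
      simp
    have hidx := hmax hall ⟨1, hK⟩
    have hpos : (0 : ℝ) < pulls (run σ ω t) ⟨1, hK⟩ := by
      exact_mod_cast Nat.pos_of_ne_zero (hall ⟨1, hK⟩)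
    have hs' : (0 : ℝ) < s := by exact_mod_cast hs
    unfold ucbIndex at hidx
    rw [empMean_run, empMean_run, heq] at hidx
    simp only [hc _ hone, Finset.sum_const, Finset.card_range, nsmul_eq_mul] at hidx
    rw [mul_div_cancel_left₀ _ hpos.ne'] at hidx
    have hmono : Real.sqrt (ρ * Real.log ((t : ℝ) + 1) / s) ≤ Real.sqrt (ρ * Real.log n / s) := by
      have : Real.log ((t : ℝ) + 1) ≤ Real.log n :=
        Real.log_le_log (by positivity) (by exact_mod_cast ht)
      gcongr
    have := Real.sqrt_nonneg (ρ * Real.log ((t : ℝ) + 1) / pulls (run σ ω t) ⟨1, hK⟩)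
    linarith

/-- The number of heads among the first tosses of the coin has a binomial law. -/
theorem choose_div_two_pow_le_measureReal (c : unitInterval) (s m : ℕ) :
    (s.choose m : ℝ) / 2 ^ s ≤
      (law (coinEnv K c)).real {ω | ∑ i ∈ Finset.range s, (ω.1 (0, i) : ℝ) = m} := by
  classical
  set I : Finset (Fin K × ℕ) := (Finset.range s).image (Prod.mk 0) with hI
  -- The cylinder on which the heads among the first `s` tosses occur exactly at `A`. The cylinders
  -- with `A` of size `m` are disjoint, each of mass `2^(-s)`.
  set B : Finset ℕ → Set (Fin K × ℕ → unitInterval) := fun A =>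
    Set.pi I fun i => if i.2 ∈ A then {1} else {0} with hB
  have hmem : ∀ A x, x ∈ B A ↔ ∀ i < s, x (0, i) = if i ∈ A then 1 else 0 := by
    intro A x
    simp only [hB, hI, Set.mem_pi, Finset.coe_image, Set.mem_image, Finset.mem_coe,
      Finset.mem_range, forall_exists_index, and_imp, forall_apply_eq_imp_iff₂]
    refine forall₂_congr fun i _ => ?_
    split_ifs <;> simp
  have hm : ∀ (A : Finset ℕ) (i : Fin K × ℕ),
      MeasurableSet (if i.2 ∈ A then {1} else {0} : Set unitInterval) := by
    intro A i
    split_ifs <;> exact measurableSet_singleton _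
  have hBm : ∀ A, MeasurableSet (B A) := fun A =>
    MeasurableSet.pi I.countable_toSet fun i _ => hm A i
  have hBμ : ∀ A, (Measure.infinitePi fun i : Fin K × ℕ =>
      (coinEnv K c i.1 : Measure unitInterval)) (B A) = 2⁻¹ ^ s := by
    intro A
    rw [hB, Measure.infinitePi_pi _ fun i _ => hm A i, hI,
      Finset.prod_image (Prod.mk_right_injective (0 : Fin K)).injOn]
    calc _ = ∏ _i ∈ Finset.range s, (2⁻¹ : ENNReal) := Finset.prod_congr rfl fun i _ => by
          simp only [coinEnv, if_true]
          split_ifs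
          · exact twoPoint_half_apply_singleton (Or.inr rfl)
          · exact twoPoint_half_apply_singleton (Or.inl rfl)
      _ = _ := by simp
  have hdisj : Set.PairwiseDisjoint
      ((Finset.range s).powersetCard m : Set (Finset ℕ)) B := by
    intro A hA A' hA' hne
    rw [Finset.mem_coe, Finset.mem_powersetCard] at hA hA'
    rw [Function.onFun, Set.disjoint_left]
    intro x hx hx'
    refine hne (Finset.ext fun i => ?_)
    by_cases his : i < s
    · have h1 := ((hmem A x).1 hx i his).symm.trans ((hmem A' x).1 hx' i his)
      by_cases hiA : i ∈ A <;> by_cases hiA' : i ∈ A' <;> simp_all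
    · exact ⟨fun h => absurd (Finset.mem_range.1 (hA.1 h)) his,
        fun h => absurd (Finset.mem_range.1 (hA'.1 h)) his⟩
  set U := ⋃ A ∈ (Finset.range s).powersetCard m, B A with hU
  have hUm : MeasurableSet U := Finset.measurableSet_biUnion _ fun A _ => hBm A
  have hsub : (Prod.fst ⁻¹' U : Set (Sample K)) ⊆
      {ω | ∑ i ∈ Finset.range s, (ω.1 (0, i) : ℝ) = m} := by
    intro ω hω
    simp only [hU, Set.mem_preimage, Set.mem_iUnion, Finset.mem_powersetCard] at hω
    obtain ⟨A, ⟨hAs, hAm⟩, hx⟩ := hω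
    rw [hmem] at hx
    rw [Set.mem_ofPred_eq]
    calc ∑ i ∈ Finset.range s, (ω.1 (0, i) : ℝ)
        = ∑ i ∈ Finset.range s, if i ∈ A then (1 : ℝ) else 0 :=
          Finset.sum_congr rfl fun i hi => by
            rw [hx i (Finset.mem_range.1 hi)]
            split_ifs <;> simp
      _ = m := by
          rw [Finset.sum_ite_mem, Finset.inter_eq_right.2 hAs]
          simp [hAm]
  have hlaw : (law (coinEnv K c)) (Prod.fst ⁻¹' U) = (s.choose m : ENNReal) * 2⁻¹ ^ s := by
    rw [law, measurePreserving_fst.measure_preimage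
      hUm.nullMeasurableSet, hU, measure_biUnion_finset hdisj fun A _ => hBm A]
    simp [hBμ]
  calc (s.choose m : ℝ) / 2 ^ s = (law (coinEnv K c)).real (Prod.fst ⁻¹' U) := by
        rw [Measure.real, hlaw]
        simp [div_eq_mul_inv]
    _ ≤ _ := measureReal_mono hsub

theorem le_expRegret_coinEnv {ρ : ℝ} (hρ : 0 < ρ) (hK : 2 ≤ K) {σ : Policy K} (hσ : IsUCB ρ σ)
    {c : unitInterval} (hc : (c : ℝ) ≤ 1 / 2) {s m n : ℕ} (hs : 0 < s) (hsn : s ≤ n)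
    (hbad : (m : ℝ) / s + Real.sqrt (ρ * Real.log n / s) < c) :
    (1 / 2 - c) * (((n : ℝ) - s) * ((s.choose m : ℝ) / 2 ^ s)) ≤
      expRegret σ (coinEnv K c) n := by
  rw [expRegret_coinEnv hc]
  refine mul_le_mul_of_nonneg_left ?_ (sub_nonneg.2 hc)
  set E : Set (Sample K) := {ω | ∑ i ∈ Finset.range s, (ω.1 (0, i) : ℝ) = m} with hE
  have hEm : MeasurableSet E :=
    (Finset.measurable_sum _ fun i _ => measurable_reward (0, i)) (measurableSet_singleton _)
  have hns : (0 : ℝ) ≤ (n : ℝ) - s := sub_nonneg.2 (by exact_mod_cast hsn)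
  calc ((n : ℝ) - s) * ((s.choose m : ℝ) / 2 ^ s)
      ≤ ((n : ℝ) - s) * (law (coinEnv K c)).real E :=
        mul_le_mul_of_nonneg_left (choose_div_two_pow_le_measureReal c s m) hns
    _ = ∫ ω, E.indicator (fun _ => (n : ℝ) - s) ω ∂law (coinEnv K c) := by
        rw [integral_indicator_const _ hEm, smul_eq_mul, mul_comm]
    _ ≤ _ := by
        refine integral_mono_ae ((integrable_const _).indicator hEm)
          ((integrable_const _).sub (integrable_pulls σ _ n 0)) ?_
        filter_upwards [ae_arm_mem_support σ (coinEnv K c), ae_reward_coinEnv c] with ω h1 h2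
        by_cases hω : ω ∈ E
        · rw [Set.indicator_of_mem hω]
          have hω' : ∑ i ∈ Finset.range s, (ω.1 (0, i) : ℝ) = m := hω
          have := pulls_zero_le hρ hK hσ h1 h2 hs (by rw [hω']; exact hbad) (le_refl n)
          have : (pulls (run σ ω n) 0 : ℝ) ≤ s := by exact_mod_cast this
          linarith
        · rw [Set.indicator_of_notMem hω]
          have : (pulls (run σ ω n) 0 : ℝ) ≤ n := by exact_mod_cast pulls_le _ _
          linarith

end Bandit

/-! ### Choice of the parameters and growth of the regret -/

namespace Bandit

variable {K : ℕ} [NeZero K]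

/-- A lower bound on the regret when the gap is `δ ^ 2`. -/
theorem rpow_div_log_le_expRegret_coinEnv {ρ : ℝ} (hρ : 0 < ρ) (hK : 2 ≤ K) {σ : Policy K}
    (hσ : IsUCB ρ σ) {δ : ℝ} (hδ0 : 0 < δ) (hδ1 : δ ≤ 1 / 8) {c : unitInterval}
    (hc : (c : ℝ) = 1 / 2 - δ ^ 2) {n : ℕ} (hn : 1 ≤ n)
    (hlog : 1 / δ ^ 2 ≤ ρ / δ ^ 2 * Real.log n) (hhalf : ρ / δ ^ 2 * Real.log n + 1 ≤ n / 2) :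
    δ ^ 2 / 2 * Real.exp (-1) *
        ((n : ℝ) ^ (1 - 2 * ρ * ((1 + 2 * δ) ^ 2 * (1 + 8 * δ * (1 + 2 * δ)))) /
          (ρ / δ ^ 2 * Real.log n + 2)) ≤
      expRegret σ (coinEnv K c) n := by
  have hn0 : (0 : ℝ) < n := by exact_mod_cast hn
  set C := ρ / δ ^ 2 with hC
  -- Just enough tosses for the coin's bonus at round `n` to be at most `δ`.
  set s := ⌈C * Real.log n⌉₊ with hs
  have hlogC : 0 < C * Real.log n := lt_of_lt_of_le (by positivity) hlog
  have hs_ge : C * Real.log n ≤ s := Nat.le_ceil _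
  have hs_lt : (s : ℝ) < C * Real.log n + 1 := Nat.ceil_lt_add_one hlogC.le
  have hs0 : (0 : ℝ) < s := hlogC.trans_le hs_ge
  have hs0' : 0 < s := by exact_mod_cast hs0
  have hsn : (s : ℝ) ≤ n / 2 := by linarith
  have hδ2 : δ ^ 2 ≤ δ / 8 := by nlinarith
  have hδ2' : 0 < δ ^ 2 := by positivity
  set v := (s : ℝ) * (1 / 2 - δ - δ ^ 2) with hv
  have hv0 : 0 < v := mul_pos hs0 (by linarith)
  -- The largest integer strictly below `v`: the mean `m / s` must be strictly less than `c - δ`.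
  set m := ⌈v⌉₊ - 1 with hm
  have hceil : 1 ≤ ⌈v⌉₊ := Nat.one_le_iff_ne_zero.2 (Nat.ceil_pos.2 hv0).ne'
  have hm_cast : (m : ℝ) = ⌈v⌉₊ - 1 := by rw [hm, Nat.cast_sub hceil, Nat.cast_one]
  have hm_lt : (m : ℝ) < v := by linarith [Nat.ceil_lt_add_one hv0.le]
  have hm_ge : v ≤ (m : ℝ) + 1 := by linarith [Nat.le_ceil v]
  have hms : m ≤ s := by
    have : (m : ℝ) ≤ s := by nlinarith
    exact_mod_cast this
  set z := 1 - 2 * (m : ℝ) / s with hz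
  have hmz : 2 * (m : ℝ) = s * (1 - z) := by
    rw [hz]
    field_simp
    ring
  -- Rounding to `m` gives `z ≤ 2δ + 2δ² + 2/s`, and `hlog` gives `1/s ≤ δ²`.
  set Z := 2 * δ + 4 * δ ^ 2 with hZ
  have hz0 : 0 ≤ z := by
    rw [hz, sub_nonneg, div_le_one hs0]
    nlinarith
  have hzZ : z ≤ Z := by
    have h1 : 1 ≤ s * δ ^ 2 := by
      have := hlog.trans hs_ge
      rwa [div_le_iff₀ (by positivity)] at this
    refine le_of_mul_le_mul_left ?_ hs0
    nlinarith
  have hZ1 : Z ≤ 1 / 2 := by nlinarith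
  have hZ0 : 0 ≤ Z := by positivity
  have hsqrt : Real.sqrt (ρ * Real.log n / s) ≤ δ := by
    refine Real.sqrt_le_iff.2 ⟨hδ0.le, ?_⟩
    rw [div_le_iff₀ hs0]
    have : ρ * Real.log n = δ ^ 2 * (C * Real.log n) := by
      rw [hC]
      field_simp
    rw [this]
    gcongr
  have hbad : (m : ℝ) / s + Real.sqrt (ρ * Real.log n / s) < c := by
    have : (m : ℝ) / s < 1 / 2 - δ - δ ^ 2 := by
      rw [div_lt_iff₀ hs0]
      linarith
    rw [hc]
    linarith
  have hmain := le_expRegret_coinEnv hρ hK hσ (c := c) (by rw [hc]; linarith) hs0'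
    (by
      have : (s : ℝ) ≤ n := by linarith
      exact_mod_cast this) hbad
  refine le_trans ?_ hmain
  have hchoose := exp_neg_div_le_choose_div_two_pow hs0' hms hz0 (hzZ.trans hZ1) hmz
  have hpoly : (z ^ 2 + 4 * z ^ 3) / 2 ≤ (Z ^ 2 + 4 * Z ^ 3) / 2 := by gcongr
  have hpoly1 : (Z ^ 2 + 4 * Z ^ 3) / 2 ≤ 1 := by
    have h2 : Z ^ 2 ≤ (1 / 2) ^ 2 := by gcongr
    have h3 : Z ^ 3 ≤ (1 / 2) ^ 3 := by gcongr
    linarith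
  set φ := (1 + 2 * δ) ^ 2 * (1 + 8 * δ * (1 + 2 * δ)) with hφ
  have hCZ : C * ((Z ^ 2 + 4 * Z ^ 3) / 2) = 2 * ρ * φ := by
    rw [hC, hφ, hZ]
    field_simp
    ring
  -- The `+ 1` pays for rounding `s` up and is the origin of the factor `exp (-1)`.
  have hexponent : (s : ℝ) * ((z ^ 2 + 4 * z ^ 3) / 2) ≤ 2 * ρ * φ * Real.log n + 1 := by
    have hnn : 0 ≤ (Z ^ 2 + 4 * Z ^ 3) / 2 := by positivity
    calc (s : ℝ) * ((z ^ 2 + 4 * z ^ 3) / 2)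
        ≤ (C * Real.log n + 1) * ((Z ^ 2 + 4 * Z ^ 3) / 2) := by gcongr
      _ = C * ((Z ^ 2 + 4 * Z ^ 3) / 2) * Real.log n + (Z ^ 2 + 4 * Z ^ 3) / 2 := by ring
      _ ≤ _ := by
          rw [hCZ]
          linarith
  have hpow : (n : ℝ) ^ (1 - 2 * ρ * φ) * Real.exp (-1) =
      n * Real.exp (-(2 * ρ * φ * Real.log n + 1)) := by
    rw [Real.rpow_sub hn0, Real.rpow_one, Real.rpow_def_of_pos hn0, div_eq_mul_inv,
      ← Real.exp_neg, mul_assoc, ← Real.exp_add]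
    congr 2
    ring
  have hgap : 1 / 2 - (c : ℝ) = δ ^ 2 := by
    rw [hc]
    ring
  rw [hgap]
  calc δ ^ 2 / 2 * Real.exp (-1) * ((n : ℝ) ^ (1 - 2 * ρ * φ) / (C * Real.log n + 2))
      = δ ^ 2 * ((n / 2) * (Real.exp (-(2 * ρ * φ * Real.log n + 1)) / (C * Real.log n + 2))) := by
        linear_combination (δ ^ 2 / 2 / (C * Real.log n + 2)) * hpow
    _ ≤ δ ^ 2 * (((n : ℝ) - s) *
          (Real.exp (-(s * ((z ^ 2 + 4 * z ^ 3) / 2))) / ((s : ℝ) + 1))) := by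
        have h1 : (n : ℝ) / 2 ≤ n - s := by linarith
        have h2 : (s : ℝ) + 1 ≤ C * Real.log n + 2 := by linarith
        have h3 : (0 : ℝ) ≤ n - s := by linarith
        gcongr
    _ ≤ _ := by
        have h3 : (0 : ℝ) ≤ n - s := by linarith
        gcongr

/-- The factor multiplying `2ρ` tends to `1` as `δ → 0`. Half of `ε` is spent here; the other half
leaves a power of `n` to beat the logarithm. -/
theorem exists_gap_parameter (ρ : ℝ) {ε : ℝ} (hε : 0 < ε) :
    ∃ δ : ℝ, 0 < δ ∧ δ ≤ 1 / 8 ∧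
      2 * ρ * ((1 + 2 * δ) ^ 2 * (1 + 8 * δ * (1 + 2 * δ))) ≤ 2 * ρ + ε / 2 := by
  have hcont : Continuous fun δ : ℝ =>
      2 * ρ * ((1 + 2 * δ) ^ 2 * (1 + 8 * δ * (1 + 2 * δ))) := by fun_prop
  have hlim : Tendsto (fun δ : ℝ => 2 * ρ * ((1 + 2 * δ) ^ 2 * (1 + 8 * δ * (1 + 2 * δ))))
      (nhdsWithin 0 (Set.Ioi 0)) (nhds (2 * ρ)) := by
    have := (hcont.tendsto 0).mono_left (nhdsWithin_le_nhds (s := Set.Ioi 0))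
    simpa using this
  have h1 : ∀ᶠ δ : ℝ in nhdsWithin 0 (Set.Ioi 0), δ ∈ Set.Ioc (0 : ℝ) (1 / 8) :=
    Ioc_mem_nhdsGT (by norm_num)
  obtain ⟨δ, hδ, hδ'⟩ := (h1.and (hlim.eventually_le_const
    (by linarith : 2 * ρ < 2 * ρ + ε / 2))).exists
  exact ⟨δ, hδ.1, hδ.2, hδ'⟩

theorem tendsto_rpow_div_log_atTop {r C D : ℝ} (hr : 0 < r) (hC : 0 < C) (hD : 0 < D) :
    Tendsto (fun n : ℕ => (n : ℝ) ^ r / (C * Real.log n + D)) atTop atTop := by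
  have hpow : Tendsto (fun n : ℕ => (n : ℝ) ^ r) atTop atTop :=
    (tendsto_rpow_atTop hr).comp tendsto_natCast_atTop_atTop
  have hlog : (fun n : ℕ => C * Real.log n + D) =o[atTop] fun n : ℕ => (n : ℝ) ^ r := by
    refine IsLittleO.add (IsLittleO.const_mul_left ?_ C) ?_
    · exact (isLittleO_log_rpow_atTop hr).comp_tendsto tendsto_natCast_atTop_atTop
    · exact isLittleO_const_left.2 (Or.inr (tendsto_norm_atTop_atTop.comp hpow))
  have hpos : ∀ᶠ n : ℕ in atTop, 0 < (C * Real.log n + D) / (n : ℝ) ^ r := by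
    filter_upwards [eventually_gt_atTop 0] with n hn
    have : (0 : ℝ) < n := by exact_mod_cast hn
    have := Real.log_natCast_nonneg n
    positivity
  have h := (tendsto_nhdsWithin_iff.2 ⟨hlog.tendsto_div_nhds_zero, hpos⟩).inv_tendsto_nhdsGT_zero
  refine h.congr fun n => ?_
  simp

/-- On a well-chosen environment, the regret of every `UCB(ρ)` policy is of order at least
`n ^ (1 - 2 * ρ - ε)`. -/
theorem exists_env_tendsto_expRegret_div_atTop {ρ : ℝ} (hρ : 0 < ρ) (hK : 2 ≤ K) {ε : ℝ}
    (hε : 0 < ε) :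
    ∃ c : unitInterval, ∀ σ : Policy K, IsUCB ρ σ →
      Tendsto (fun n : ℕ => expRegret σ (coinEnv K c) n / (n : ℝ) ^ (1 - 2 * ρ - ε))
        atTop atTop := by
  obtain ⟨δ, hδ0, hδ1, hδ⟩ := exists_gap_parameter ρ hε
  have hδ2 : δ ^ 2 ≤ 1 / 2 := by nlinarith
  have hδ2' : 0 < δ ^ 2 := by positivity
  refine ⟨⟨1 / 2 - δ ^ 2, by linarith, by linarith⟩, fun σ hσ => ?_⟩
  have hC : 0 < ρ / δ ^ 2 := by positivity
  have hlim := (tendsto_rpow_div_log_atTop (half_pos hε) hC two_pos).const_mul_atTop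
    (by positivity : 0 < δ ^ 2 / 2 * Real.exp (-1))
  refine tendsto_atTop_mono' _ ?_ hlim
  have hlog : Tendsto (fun n : ℕ => ρ / δ ^ 2 * Real.log n) atTop atTop :=
    (Real.tendsto_log_atTop.comp tendsto_natCast_atTop_atTop).const_mul_atTop hC
  -- The last condition, `n / (C log n + 1) ≥ 2`, makes the tosses fit into the first half of the
  -- rounds.
  filter_upwards [eventually_ge_atTop 1, hlog.eventually_ge_atTop (1 / δ ^ 2),
    (tendsto_rpow_div_log_atTop one_pos hC one_pos).eventually_ge_atTop 2] with n hn h1 h2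
  have hn0 : (0 : ℝ) < n := by exact_mod_cast hn
  have hn1 : (1 : ℝ) ≤ n := by exact_mod_cast hn
  have hlogn := Real.log_natCast_nonneg n
  rw [Real.rpow_one, le_div_iff₀ (by positivity)] at h2
  have hmain := rpow_div_log_le_expRegret_coinEnv hρ hK hσ hδ0 hδ1
    (c := ⟨1 / 2 - δ ^ 2, by linarith, by linarith⟩) rfl hn h1 (by linarith)
  rw [le_div_iff₀ (by positivity)]
  refine le_trans ?_ hmain
  have hpow : (n : ℝ) ^ (ε / 2) * (n : ℝ) ^ (1 - 2 * ρ - ε) ≤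
      (n : ℝ) ^ (1 - 2 * ρ * ((1 + 2 * δ) ^ 2 * (1 + 8 * δ * (1 + 2 * δ)))) := by
    rw [← Real.rpow_add hn0]
    exact Real.rpow_le_rpow_of_exponent_le hn1 (by linarith)
  rw [mul_assoc]
  refine mul_le_mul_of_nonneg_left ?_ (by positivity)
  rw [div_mul_eq_mul_div]
  gcongr

end Bandit

theorem mainTheorem2 (K : ℕ) [NeZero K] (hK : 2 ≤ K)
    (Θ : Fin K → Set (ProbabilityMeasure unitInterval))
    (hΘ : ∀ (k : Fin K) (p a b : unitInterval), Bandit.twoPoint p a b ∈ Θ k)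
    (ρ : ℝ) (hρ : ρ ∈ Set.Ioo (0 : ℝ) (1 / 2)) :
    (∀ σ : Bandit.Policy K, Bandit.IsUCB ρ σ →
      (∀ θ ∈ Set.univ.pi Θ, ∀ β ∈ Set.Ioo (0 : ℝ) 1, ∀ n : ℕ, 1 ≤ n →
        Bandit.expRegret σ θ n ≤
          ∑ k with 0 < Bandit.gap θ k,
            (4 * Real.log n / Bandit.gap θ k +
              2 * Bandit.gap θ k * (Real.log n / Real.log (1 / β) + 1) *
                ((n : ℝ) ^ (1 - 2 * ρ * β) / (1 - 2 * ρ * β)))) ∧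
      Bandit.IsConsistent (1 - 2 * ρ) (Set.univ.pi Θ) σ) ∧
    (∀ ε > (0 : ℝ), ∃ θ ∈ Set.univ.pi Θ, ∀ σ : Bandit.Policy K, Bandit.IsUCB ρ σ →
      Tendsto (fun n : ℕ => Bandit.expRegret σ θ n / (n : ℝ) ^ (1 - 2 * ρ - ε)) atTop atTop) := by
  refine ⟨fun σ hσ => ⟨fun θ _ β hβ n hn =>
    Bandit.expRegret_le hρ.1 hρ.2 hσ θ hβ.1 hβ.2 hn,
    Bandit.isConsistent_of_isUCB hρ.1 hρ.2 hσ _⟩, fun ε hε => ?_⟩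
  obtain ⟨c, hc⟩ := Bandit.exists_env_tendsto_expRegret_div_atTop (K := K) hρ.1 hK hε
  refine ⟨Bandit.coinEnv K c, fun k _ => ?_, hc⟩
  unfold Bandit.coinEnv
  split_ifs
  · exact hΘ _ _ _ _
  · exact hΘ _ _ _ _
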